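/- \textbf{Lattices.} Let $M_1\subset\mathbb{C}$ be a regular hexagonal lattice of edge length $1$, let $\lambda_n>0$ with $\lambda_n\to 0$, and let $M_{\lambda_n}=\lambda_n M_1$ be its image under the homothety $z\mapsto\lambda_n z$, with vertex set $V_n$. \textbf{Data.} Let $g$ and $q$ be entire functions, $g'(z)\neq 0$ for all $z$, and write $g_a=g(v_a)$, $dg(e_{ab})=g_b-g_a$, $dz(e_{ab})=v_b-v_a$ for an oriented edge $e_{ab}$ from $v_a$ to $v_b$. Assume $g_a\ne g_b$ for adjacent vertices of every $M_{\lambda_n}$. For each $n$ let $q_n$ be a discrete holomorphic quadratic differential on $M_{\lambda_n}$ associated with $g$, that is, a complex function on the edges with $q_n(e_{ab})=q_n(e_{ba})$ such that, with $\tau_n$ defined by $q_n(e)=i\,\overline{\tau_n(e)}\,dg(e)$, at every vertex the sums of $q_n(e)$ and of $\tau_n(e)$ over the three edges $e$ emerging from that vertex vanish. Assume that the $q_n$ discretise the common quadratic differential $q(z)\,dz^2$: for every compact $K\subset\mathbb{C}$, $q_n(e)/dz(e)^2-q(o(e))\to 0$ uniformly over the edges $e$ of $M_{\lambda_n}$ with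 origin $o(e)\in K$. \textbf{Surfaces.} Let $X_{\lambda_n}\colon V_n\to\mathbb{R}^3$ be given by these data through the discrete Weierstrass formula, that is, for every oriented edge, $$X_{\lambda_n}(v_b)-X_{\lambda_n}(v_a)=\mathrm{Re}\Big[\frac{i\,q_n(e_{ab})}{dg(e_{ab})}\big(1-g_ag_b,\ i(1+g_ag_b),\ g_a+g_b\big)\Big],$$ and let the constants of integration converge: $X_{\lambda_n}(\lambda_n v_0)\to x_0$ for some vertex $v_0$ of $M_1$ and some $x_0\in\mathbb{R}^3$. Let $X_\infty\colon\mathbb{C}\to\mathbb{R}^3$, $$X_\infty(z)=x_0+\mathrm{Re}\int_0^z\frac{Q}{g'}\Big(\tfrac12(1-g^2),\ \tfrac i2(1+g^2),\ g\Big)dz,\qquad Q=2iq,$$ be the classical Weierstrass surface with the same data, let $N(w)=\frac{1}{1+|w|^2}(w+\bar w,\ i(\bar w-w),\ |w|^2-1)$, let $N_n=N\circ g|_{V_n}$ be the pseudo-normal, and $U=\{z: q(z)\neq0\}$. \textbf{Curvatures.} At a vertex $v_0$ with neighbours $v_1,v_2,v_3$, for each of the three triangles $(0,a,b)$ put $I_{ab}=(\langle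 X_i-X_0,X_j-X_0\rangle)_{i,j\in\{a,b\}}$, $I\!I_{ab}=(\langle X_i-X_0,N_j-N_0\rangle)_{i,j\in\{a,b\}}$, $H_{ab}=\frac12\operatorname{tr}(I_{ab}^{-1}I\!I_{ab})$, $K_{ab}=\det(I_{ab}^{-1}I\!I_{ab})$. The discrete mean and Gauss curvatures $H_n(v_0)$, $K_n(v_0)$ of $X_{\lambda_n}$ are the averages of $H_{ab}$, $K_{ab}$ over the three triangles with weights proportional to $\sqrt{\det I_{ab}}$. Those of $X_\infty$ are $H_\infty=\frac12\operatorname{tr}(I^{-1}I\!I)$, $K_\infty=\det(I^{-1}I\!I)$ with $I=(\langle\partial_iX_\infty,\partial_jX_\infty\rangle)$, $I\!I=(\langle\partial_iX_\infty,\partial_jN_\infty\rangle)$, where $N_\infty$ is the unit normal in the direction of $\partial_uX_\infty\times\partial_vX_\infty$ and $z=u+iv$. \textbf{Theorem.} Every $X_{\lambda_n}$ is a discrete harmonic surface (the sum of $X_{\lambda_n}(v_b)-X_{\lambda_n}(v_a)$ over the three neighbours $v_b$ of $v_a$ vanishes at every $v_a$). The map $X_\infty$ is smooth, and on $U$ it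 is an immersion with $H_\infty=0$ (a minimal surface) and unit normal $N_\infty=N\circ g$. The $X_{\lambda_n}$ converge to $X_\infty$: for every closed disc $B\subset\mathbb{C}$ of positive radius, the Hausdorff distance between $X_{\lambda_n}(V_n\cap B)$ and $X_\infty(B)$ tends to $0$, and $X_{\lambda_n}\to X_\infty$ smoothly on $\mathbb{C}$. The curvatures converge smoothly on $U$: $H_n\to H_\infty$ and $K_n\to K_\infty$. Here $f_n\to f$ smoothly on an open set $W$, for functions $f_n$ on $V_n$ and $f$ on $W$, means: for every $k\ge0$, all periods $w_1,\dots,w_k$ of $M_1$ and every compact $K\subset W$, $D_{w_1}\cdots D_{w_k}f_n-\partial_{w_1}\cdots\partial_{w_k}f\to0$ uniformly on $V_n\cap K$, where $(D_wf_n)(v)=\lambda_n^{-1}\big(f_n(v+\lambda_nw)-f_n(v)\big)$ and $\partial_w$ is the directional derivative. -/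

import Mathlib

open Filter Topology Complex
open scoped ContDiff Matrix

noncomputable section

namespace DiscreteWeierstrass

/-- Euclidean three-space. -/
abbrev E3 : Type := EuclideanSpace ℝ (Fin 3)

/-! ### Regular hexagonal lattices -/

/-- The vertices of the hexagonal (honeycomb) lattice: two per period cell, a black one and a
white one. -/
structure HexVertex where
  m : ℤ
  n : ℤ
  white : Bool

/-- The three neighbours of a vertex. The pair `(v, j)` stands for the oriented edge from `v` to
`nbr v j`, and its reverse is `(nbr v j, j)`, see `nbr_nbr`. -/
def nbr : HexVertex → Fin 3 → HexVertex
  | ⟨m, n, false⟩, j => ⟨m - ![0, 1, 0] j, n - ![0, 0, 1] j, true⟩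
  | ⟨m, n, true⟩, j => ⟨m + ![0, 1, 0] j, n + ![0, 0, 1] j, false⟩

theorem nbr_nbr (v : HexVertex) (j : Fin 3) : nbr (nbr v j) j = v := by
  rcases v with ⟨m, n, _ | _⟩ <;> simp [nbr]

/-- The translation of the lattice by the period `w`. -/
def translate (v : HexVertex) (w : ℤ × ℤ) : HexVertex := ⟨v.m + w.1, v.n + w.2, v.white⟩

/-- The cube root of unity `exp (2πi/3)`. -/
def omega : ℂ := exp (2 * Real.pi * I / 3)

/-- The period vector of `w` in the standard hexagonal lattice of edge length one. -/
def period (w : ℤ × ℤ) : ℂ := w.1 * (1 - omega) + w.2 * (1 - omega ^ 2)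

/-- The position of a vertex in the standard hexagonal lattice of edge length one. -/
def pos (v : HexVertex) : ℂ := period (v.m, v.n) + if v.white then 1 else 0

/-- The neighbours of a black vertex are at `1, ω, ω²` from it, those of a white one at
`-1, -ω, -ω²`. -/
theorem pos_nbr (v : HexVertex) (j : Fin 3) :
    pos (nbr v j) = pos v + (if v.white then -1 else 1) * omega ^ (j : ℕ) := by
  rcases v with ⟨m, n, _ | _⟩ <;> fin_cases j <;> simp [nbr, pos, period] <;> ring

theorem pos_translate (v : HexVertex) (w : ℤ × ℤ) :
    pos (translate v w) = pos v + period w := by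
  rcases v with ⟨m, n, _ | _⟩ <;> simp [pos, translate, period] <;> ring

/-- The complex coordinate of the lattice `M_l`, the image under the homothety `z ↦ l z` of the
regular hexagonal lattice of edge length one which has a vertex at `p` and an edge in the direction
`ζ`, where `|ζ| = 1`. -/
def coord (p ζ : ℂ) (l : ℝ) (v : HexVertex) : ℂ := l * (p + ζ * pos v)

theorem norm_coord_nbr_sub (p ζ : ℂ) (hζ : ‖ζ‖ = 1) (l : ℝ) (hl : 0 < l) (v : HexVertex)
    (j : Fin 3) : ‖coord p ζ l (nbr v j) - coord p ζ l v‖ = l := by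
  have hω : ‖omega‖ = 1 := by
    have : omega = exp ((2 * Real.pi / 3 : ℝ) * I) := by
      unfold omega; congr 1; push_cast; ring
    rw [this, norm_exp_ofReal_mul_I]
  have : coord p ζ l (nbr v j) - coord p ζ l v
      = l * (ζ * ((if v.white then -1 else 1) * omega ^ (j : ℕ))) := by
    simp only [coord, pos_nbr]; ring
  rw [this]
  split_ifs <;> simp [hζ, hω, abs_of_pos hl]

/-! ### Discrete Weierstrass data and discrete harmonic surfaces

Below `z : HexVertex → ℂ` is the complex coordinate of a lattice and `g` a function on `ℂ`. -/

/-- The difference `dg(e) = g_b - g_a` along the oriented edge `e = (v, j)` from `a` to `b`. -/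
def dAlong (g : ℂ → ℂ) (z : HexVertex → ℂ) (v : HexVertex) (j : Fin 3) : ℂ :=
  g (z (nbr v j)) - g (z v)

/-- The Gauss map takes different values at adjacent vertices (`pseudoNormal` is injective). -/
def NonDegenerate (g : ℂ → ℂ) (z : HexVertex → ℂ) : Prop :=
  ∀ v j, g (z (nbr v j)) ≠ g (z v)

/-- The function `τ` with `q(e) = i * conj (τ e) * dg(e)`. -/
def tau (g : ℂ → ℂ) (z : HexVertex → ℂ) (q : HexVertex → Fin 3 → ℂ) (v : HexVertex) (j : Fin 3) :
    ℂ :=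
  (starRingEnd ℂ) (q v j / (I * dAlong g z v j))

/-- `q` is a discrete holomorphic quadratic differential associated with `g`: it is a function on
edges, and both `q` and `τ` sum to zero around each vertex. -/
structure IsHolomorphicQuadraticDifferential (g : ℂ → ℂ) (z : HexVertex → ℂ)
    (q : HexVertex → Fin 3 → ℂ) : Prop where
  symm : ∀ v j, q (nbr v j) j = q v j
  sum_q : ∀ v, ∑ j, q v j = 0
  sum_tau : ∀ v, ∑ j, tau g z q v j = 0

/-- The discrete Weierstrass form
`dF(e_ab) = (i q(e_ab) / dg(e_ab)) (1 - g_a g_b, i (1 + g_a g_b), g_a + g_b)`. -/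
def dF (g : ℂ → ℂ) (z : HexVertex → ℂ) (q : HexVertex → Fin 3 → ℂ) (v : HexVertex) (j : Fin 3) :
    Fin 3 → ℂ :=
  (I * q v j / dAlong g z v j) •
    ![1 - g (z v) * g (z (nbr v j)), I * (1 + g (z v) * g (z (nbr v j))),
      g (z v) + g (z (nbr v j))]

/-- `X = ∫ Re dF`: the increment of `X` along each oriented edge is the real part of `dF`. -/
def IsWeierstrassRealization (g : ℂ → ℂ) (z : HexVertex → ℂ) (q : HexVertex → Fin 3 → ℂ)
    (X : HexVertex → E3) : Prop :=
  ∀ v j, X (nbr v j) - X v = WithLp.toLp 2 fun k => (dF g z q v j k).re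

/-- The balancing condition at each vertex. -/
def IsDiscreteHarmonic (X : HexVertex → E3) : Prop :=
  ∀ v, ∑ j, (X (nbr v j) - X v) = 0

/-- The pseudo-normal
`(g + conj g, i (conj g - g), |g|² - 1) / (1 + |g|²) = (2 Re g, 2 Im g, |g|² - 1) / (1 + |g|²)`. -/
def pseudoNormal (w : ℂ) : E3 :=
  (1 + ‖w‖ ^ 2)⁻¹ • !₂[2 * w.re, 2 * w.im, ‖w‖ ^ 2 - 1]

/-! ### Curvatures -/

/-- The matrix of inner products `⟨x i, y j⟩`. -/
def innerMatrix (x y : Fin 2 → E3) : Matrix (Fin 2) (Fin 2) ℝ :=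
  Matrix.of fun i j => inner ℝ (x i) (y j)

/-- Mean curvature from the first and second fundamental forms. -/
def meanOf (A B : Matrix (Fin 2) (Fin 2) ℝ) : ℝ := (A⁻¹ * B).trace / 2

/-- Gauss curvature from the first and second fundamental forms. -/
def gaussOf (A B : Matrix (Fin 2) (Fin 2) ℝ) : ℝ := (A⁻¹ * B).det

/-- The increments of `Y` from `v` to its neighbours number `a` and `b`. -/
def increments (Y : HexVertex → E3) (v : HexVertex) (a b : Fin 3) : Fin 2 → E3 :=
  ![Y (nbr v a) - Y v, Y (nbr v b) - Y v]

/-- The first fundamental form `I_ab` of the triangle spanned by `v` and two neighbours. -/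
def triFirst (X : HexVertex → E3) (v : HexVertex) (a b : Fin 3) : Matrix (Fin 2) (Fin 2) ℝ :=
  innerMatrix (increments X v a b) (increments X v a b)

/-- The second fundamental form `II_ab`, with entries `⟨X_i - X_0, N_j - N_0⟩`. -/
def triSecond (X N : HexVertex → E3) (v : HexVertex) (a b : Fin 3) :
    Matrix (Fin 2) (Fin 2) ℝ :=
  innerMatrix (increments X v a b) (increments N v a b)

/-- The average of `f 0`, `f 1`, `f 2`, belonging to the triangles spanned by `v` and its
neighbours number `a` and `a + 1`, weighted by the areas of these triangles. -/
def areaAverage (X : HexVertex → E3) (v : HexVertex) (f : Fin 3 → ℝ) : ℝ :=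
  (∑ a, √(triFirst X v a (a + 1)).det * f a) / ∑ a, √(triFirst X v a (a + 1)).det

/-- The discrete mean curvature of `X` with respect to the field of unit vectors `N`. -/
def discreteMean (X N : HexVertex → E3) (v : HexVertex) : ℝ :=
  areaAverage X v fun a => meanOf (triFirst X v a (a + 1)) (triSecond X N v a (a + 1))

/-- The discrete Gauss curvature of `X` with respect to the field of unit vectors `N`. -/
def discreteGauss (X N : HexVertex → E3) (v : HexVertex) : ℝ :=
  areaAverage X v fun a => gaussOf (triFirst X v a (a + 1)) (triSecond X N v a (a + 1))

/-- The partial derivatives `(Y_u, Y_v)` of a map `Y` of `z = u + i v`. -/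
def partials (Y : ℂ → E3) (z : ℂ) : Fin 2 → E3 := ![fderiv ℝ Y z 1, fderiv ℝ Y z I]

/-- The unit normal `X_u × X_v / |X_u × X_v|` of a parametrised surface. -/
def unitNormal (X : ℂ → E3) (z : ℂ) : E3 :=
  let c : E3 := WithLp.toLp 2 ((partials X z 0).ofLp ⨯₃ (partials X z 1).ofLp)
  ‖c‖⁻¹ • c

/-- The first fundamental form of a parametrised surface. -/
def firstForm (X : ℂ → E3) (z : ℂ) : Matrix (Fin 2) (Fin 2) ℝ :=
  innerMatrix (partials X z) (partials X z)

/-- The second fundamental form of a parametrised surface, with the sign convention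
`⟨X_i, N_j⟩` (that is, `-⟨X_ij, N⟩`) of the discrete one. -/
def secondForm (X : ℂ → E3) (z : ℂ) : Matrix (Fin 2) (Fin 2) ℝ :=
  innerMatrix (partials X z) (partials (unitNormal X) z)

/-- The mean curvature of a parametrised surface. -/
def smoothMean (X : ℂ → E3) (z : ℂ) : ℝ := meanOf (firstForm X z) (secondForm X z)

/-- The Gauss curvature of a parametrised surface. -/
def smoothGauss (X : ℂ → E3) (z : ℂ) : ℝ := gaussOf (firstForm X z) (secondForm X z)

/-- `X` is an immersed minimal surface on the open set `U`. -/
def IsMinimalImmersionOn (X : ℂ → E3) (U : Set ℂ) : Prop :=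
  ContDiffOn ℝ ∞ X U ∧ ∀ z ∈ U, LinearIndependent ℝ (partials X z) ∧ smoothMean X z = 0

/-! ### The classical Weierstrass representation -/

/-- The integrand `(Q / g') ((1 - g²) / 2, i (1 + g²) / 2, g)`. -/
def weierstrassForm (g Q : ℂ → ℂ) (z : ℂ) : Fin 3 → ℂ :=
  (Q z / deriv g z) • ![(1 - g z ^ 2) / 2, I * (1 + g z ^ 2) / 2, g z]

/-- `X(z) = x₀ + Re ∫ (Q / g') ((1 - g²) / 2, i (1 + g²) / 2, g) dz`, integrated along the segment
from `0` to `z` (for an entire integrand any path from `0` to `z` gives the same). -/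
def weierstrassSurface (g Q : ℂ → ℂ) (x₀ : E3) (z : ℂ) : E3 :=
  x₀ + WithLp.toLp 2 fun k => (∫ t in (0 : ℝ)..1, z * weierstrassForm g Q (t * z) k).re

/-! ### Modes of convergence

Here `z n : HexVertex → ℂ` is the coordinate of the `n`-th lattice. -/

/-- The discrete differentials `qd n` discretise one and the same quadratic differential
`q(z) dz²` on `ℂ`: one has `qd n (e) / dz(e)² → q` uniformly over the edges that start in a given
compact set. -/
def Discretise (z : ℕ → HexVertex → ℂ) (qd : ℕ → HexVertex → Fin 3 → ℂ) (q : ℂ → ℂ) : Prop :=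
  ∀ K : Set ℂ, IsCompact K → ∀ ε > 0, ∀ᶠ n in atTop, ∀ v j, z n v ∈ K →
    ‖qd n v j / (z n (nbr v j) - z n v) ^ 2 - q (z n v)‖ < ε

/-- The iterated difference quotient along the periods in a list, for a lattice of edge
length `l`. -/
def iterDiff {E : Type*} [AddCommGroup E] [Module ℝ E] (l : ℝ) (f : HexVertex → E) :
    List (ℤ × ℤ) → HexVertex → E
  | [], v => f v
  | w :: ws, v => l⁻¹ • (iterDiff l f ws (translate v w) - iterDiff l f ws v)

/-- Smooth convergence on `U` of functions `f n` on the lattices `coord p ζ (l n)` to `F`: on each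
compact subset of `U`, the difference quotients of each order `≥ 0` of `f n` along lattice periods
converge uniformly to the corresponding derivatives of `F`. -/
def SmoothlyConvergesOn {E : Type*} [NormedAddCommGroup E] [NormedSpace ℝ E] (p ζ : ℂ)
    (l : ℕ → ℝ) (f : ℕ → HexVertex → E) (F : ℂ → E) (U : Set ℂ) : Prop :=
  ∀ K : Set ℂ, IsCompact K → K ⊆ U → ∀ ws : List (ℤ × ℤ), ∀ ε > 0, ∀ᶠ n in atTop,
    ∀ v, coord p ζ (l n) v ∈ K →
      ‖iterDiff (l n) (f n) ws v -
        iteratedFDeriv ℝ ws.length F (coord p ζ (l n) v)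
          (fun i => ζ * period (ws.get i))‖ < ε

end DiscreteWeierstrass

end

open DiscreteWeierstrass

noncomputable section

namespace DiscreteWeierstrass

/-! ### Families of functions on a sequence of shrinking lattices -/

/-! The core is a rigidity phenomenon. At a trivalent vertex the equations `∑ q = 0` and `∑ q / dg =
0` determine the ratios of the three coefficients `q / dz²` from the increments of `g`
(`coeff_relation`). Expanding `g` to second order, the terms of order 0 and 1 in `l` cancel because
the three edge directions differ by cube roots of unity, so these ratios are `1 + o(l)`
(`defect_sc`, `edgeDiff_sc`). An edge has the same coefficient seen from either end. Hence passing
to a translated vertex through a common neighbour changes a coefficient by `o(l)`: its difference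
quotients along periods tend to zero (`coeff_quot_sc`). The common limit `q` is therefore constant.
Moreover the argument turns convergence of order `k` into convergence of order `k + 1`, so the
coefficients converge to `q 0` with all difference quotients (`coeff_sc`).

Everything else follows from a calculus of lattice functions. `SC k` expresses convergence of
difference quotients up to order `k`, and is stable under bilinear operations, inverses, square
roots, passage to neighbours and case distinction by colour. Entire functions restricted to the
lattices belong to it for every `k`, because difference quotients of locally uniformly convergent
entire functions are again such (`EntireConv.sc`). Periods preserve colour, so the two colour
classes need only share the same limit.

An elementary period is the difference of two edges, so the difference quotients of `X` are
differences of discrete Weierstrass forms. These converge to the derivative of the classical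
surface, and the base point fixes the constant (`realization_sc`). Harmonicity is algebraic: `dF` is
a combination of `q / dg` and `q` with coefficients depending only on the vertex.

For the curvatures, both fundamental forms of a triangle are `l²` times inner products of divided
increments. These converge to the classical forms evaluated on two edge directions at an angle of
120°. Trace and determinant do not depend on the basis, so all three triangles, and with them their
average, have the classical limit. -/

/-- A sequence of homothetic hexagonal lattices whose edge lengths tend to zero. -/
structure Mesh where
  p : ℂ
  ζ : ℂ
  l : ℕ → ℝ
  norm_ζ : ‖ζ‖ = 1
  l_pos : ∀ n, 0 < l n
  l_lim : Tendsto l atTop (𝓝 0)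

namespace Mesh

variable {E F G : Type*} [NormedAddCommGroup E] [NormedSpace ℝ E] [NormedAddCommGroup F]
  [NormedSpace ℝ F] [NormedAddCommGroup G] [NormedSpace ℝ G] (M : Mesh)

/-- The coordinate on the `n`-th lattice. -/
def z (n : ℕ) (v : HexVertex) : ℂ := coord M.p M.ζ (M.l n) v

/-- The period vector of `w`, before scaling. -/
def per (w : ℤ × ℤ) : ℂ := M.ζ * period w

/-- Difference quotients along a period. -/
def quot (w : ℤ × ℤ) (f : ℕ → HexVertex → E) (n : ℕ) (v : HexVertex) : E :=
  (M.l n)⁻¹ • (f n (translate v w) - f n v)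

/-- The filter of lattice points converging to `z₀` while the lattices are refined. -/
def near (z₀ : ℂ) : Filter (ℕ × HexVertex) :=
  comap Prod.fst atTop ⊓ comap (fun x => M.z x.1 x.2) (𝓝 z₀)

/-- Continuous convergence of lattice functions. -/
def Conv (f : ℕ → HexVertex → E) (φ : ℂ → E) : Prop :=
  ∀ z₀, Tendsto (fun x : ℕ × HexVertex => f x.1 x.2) (M.near z₀) (𝓝 (φ z₀))

/-- Convergence of the difference quotients of order at most `k`. -/
def SC : ℕ → (ℕ → HexVertex → E) → (ℂ → E) → Prop
  | 0, f, φ => ContDiff ℝ ∞ φ ∧ M.Conv f φ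
  | k + 1, f, φ => ContDiff ℝ ∞ φ ∧ M.Conv f φ ∧
      ∀ w, SC k (M.quot w f) (fun z => fderiv ℝ φ z (M.per w))

variable {M}

/-! ### Limits along lattice points and displacements of order `l`. -/

theorem l_ne (n : ℕ) : M.l n ≠ 0 := (M.l_pos n).ne'

theorem tendsto_fst (z₀ : ℂ) : Tendsto Prod.fst (M.near z₀) atTop :=
  tendsto_comap.mono_left inf_le_left

theorem tendsto_z (z₀ : ℂ) : Tendsto (fun x => M.z x.1 x.2) (M.near z₀) (𝓝 z₀) :=
  tendsto_comap.mono_left inf_le_right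

theorem tendsto_l (z₀ : ℂ) : Tendsto (fun x => M.l x.1) (M.near z₀) (𝓝 0) :=
  M.l_lim.comp (tendsto_fst z₀)

theorem tendsto_near {α : Type*} {L : Filter α} {a : α → ℕ × HexVertex} {z₀ : ℂ}
    (h₁ : Tendsto (fun x => (a x).1) L atTop)
    (h₂ : Tendsto (fun x => M.z (a x).1 (a x).2) L (𝓝 z₀)) : Tendsto a L (M.near z₀) :=
  tendsto_inf.2 ⟨tendsto_comap_iff.2 h₁, tendsto_comap_iff.2 h₂⟩

theorem z_translate (n : ℕ) (v : HexVertex) (w : ℤ × ℤ) :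
    M.z n (translate v w) = M.z n v + M.l n * M.per w := by
  simp only [z, coord, per, pos_translate]; ring

/-- The colour of a vertex as a sign. -/
def _root_.DiscreteWeierstrass.sgn (v : HexVertex) : ℝ := if v.white then -1 else 1

theorem z_nbr (n : ℕ) (v : HexVertex) (j : Fin 3) :
    M.z n (nbr v j) = M.z n v + M.l n * (sgn v * (M.ζ * omega ^ (j : ℕ))) := by
  simp only [z, coord, pos_nbr, sgn]; split_ifs <;> push_cast <;> ring

/-- A displacement of order `l` is invisible in the limit. -/
theorem tendsto_shift {s : HexVertex → HexVertex} {C : ℝ}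
    (hs : ∀ n v, ‖M.z n (s v) - M.z n v‖ ≤ C * M.l n) (z₀ : ℂ) :
    Tendsto (fun x : ℕ × HexVertex => (x.1, s x.2)) (M.near z₀) (M.near z₀) := by
  refine tendsto_near (tendsto_fst z₀) ?_
  have h : Tendsto (fun x : ℕ × HexVertex => M.z x.1 (s x.2) - M.z x.1 x.2) (M.near z₀) (𝓝 0) := by
    refine squeeze_zero_norm (fun x => hs x.1 x.2) ?_
    simpa using (tendsto_l (M := M) z₀).const_mul C
  simpa using h.add (tendsto_z z₀)

theorem norm_z_translate (w : ℤ × ℤ) (n : ℕ) (v : HexVertex) :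
    ‖M.z n (translate v w) - M.z n v‖ ≤ ‖M.per w‖ * M.l n := by
  rw [z_translate, add_sub_cancel_left, norm_mul, norm_real, Real.norm_of_nonneg (M.l_pos n).le,
    mul_comm]

theorem norm_z_nbr (j : Fin 3) (n : ℕ) (v : HexVertex) :
    ‖M.z n (nbr v j) - M.z n v‖ ≤ 1 * M.l n := by
  rw [one_mul]; exact (norm_coord_nbr_sub M.p M.ζ M.norm_ζ (M.l n) (M.l_pos n) v j).le

/-! ### The calculus of convergence with difference quotients. -/

theorem SC.smooth {k : ℕ} {f : ℕ → HexVertex → E} {φ : ℂ → E} (h : M.SC k f φ) :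
    ContDiff ℝ ∞ φ := by
  cases k with
  | zero => exact h.1
  | succ k => exact h.1

theorem SC.conv {k : ℕ} {f : ℕ → HexVertex → E} {φ : ℂ → E} (h : M.SC k f φ) : M.Conv f φ := by
  cases k with
  | zero => exact h.2
  | succ k => exact h.2.1

theorem SC.quot {k : ℕ} {f : ℕ → HexVertex → E} {φ : ℂ → E} (h : M.SC (k + 1) f φ) (w : ℤ × ℤ) :
    M.SC k (M.quot w f) (fun z => fderiv ℝ φ z (M.per w)) := h.2.2 w

theorem SC.of_succ {k : ℕ} {f : ℕ → HexVertex → E} {φ : ℂ → E} (h : M.SC (k + 1) f φ) :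
    M.SC k f φ := by
  induction k generalizing f φ with
  | zero => exact ⟨h.1, h.2.1⟩
  | succ k ih => exact ⟨h.1, h.2.1, fun w => ih (h.2.2 w)⟩

theorem SC.diff {k : ℕ} {f : ℕ → HexVertex → E} {φ : ℂ → E} (h : M.SC k f φ) :
    Differentiable ℝ φ := h.smooth.differentiable (by simp)

/-- Eventual equality near every point survives translation by a period. This permits identities
that are valid only where some denominator is nonzero. -/
theorem SC.congr {k : ℕ} {f g : ℕ → HexVertex → E} {φ : ℂ → E} (h : M.SC k f φ)
    (hfg : ∀ z₀, ∀ᶠ x in M.near z₀, f x.1 x.2 = g x.1 x.2) : M.SC k g φ := by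
  induction k generalizing f g φ with
  | zero => exact ⟨h.1, fun z₀ => (h.2 z₀).congr' (hfg z₀)⟩
  | succ k ih =>
    refine ⟨h.1, fun z₀ => (h.2.1 z₀).congr' (hfg z₀), fun w => ih (h.2.2 w) fun z₀ => ?_⟩
    filter_upwards [hfg z₀, (tendsto_shift (norm_z_translate w) z₀).eventually (hfg z₀)]
      with x h₁ h₂
    simp only [Mesh.quot]
    rw [h₁, h₂]

theorem SC.congr_limit {k : ℕ} {f : ℕ → HexVertex → E} {φ ψ : ℂ → E} (h : M.SC k f φ)
    (hφ : ∀ z, φ z = ψ z) : M.SC k f ψ := (funext hφ : φ = ψ) ▸ h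

/-- A map of vertices that commutes with the periods also commutes with difference quotients, and
being a displacement of order `l` it does not change limits. -/
theorem SC.shift {k : ℕ} {f : ℕ → HexVertex → E} {φ : ℂ → E} (h : M.SC k f φ)
    {s : HexVertex → HexVertex} {C : ℝ} (hs : ∀ n v, ‖M.z n (s v) - M.z n v‖ ≤ C * M.l n)
    (hsw : ∀ v w, s (translate v w) = translate (s v) w) : M.SC k (fun n v => f n (s v)) φ := by
  induction k generalizing f φ with
  | zero => exact ⟨h.1, fun z₀ => (h.2 z₀).comp (tendsto_shift hs z₀)⟩
  | succ k ih =>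
    refine ⟨h.1, fun z₀ => (h.2.1 z₀).comp (tendsto_shift hs z₀), fun w => ?_⟩
    convert ih (h.2.2 w) using 1
    funext n v
    simp only [Mesh.quot, hsw]

theorem SC.translate {k : ℕ} {f : ℕ → HexVertex → E} {φ : ℂ → E} (h : M.SC k f φ) (w : ℤ × ℤ) :
    M.SC k (fun n v => f n (translate v w)) φ :=
  h.shift (norm_z_translate w) fun v w' => by
    simp [DiscreteWeierstrass.translate, add_right_comm]

theorem SC.nbr {k : ℕ} {f : ℕ → HexVertex → E} {φ : ℂ → E} (h : M.SC k f φ) (j : Fin 3) :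
    M.SC k (fun n v => f n (nbr v j)) φ :=
  h.shift (norm_z_nbr j) fun v w' => by
    rcases v with ⟨m, n, _ | _⟩ <;>
      simp [DiscreteWeierstrass.translate, DiscreteWeierstrass.nbr] <;> constructor <;> ring

theorem SC.const (k : ℕ) (c : E) : M.SC k (fun _ _ => c) fun _ => c := by
  induction k generalizing c with
  | zero => exact ⟨contDiff_const, fun z₀ => tendsto_const_nhds⟩
  | succ k ih =>
    refine ⟨contDiff_const, fun z₀ => tendsto_const_nhds, fun w => ?_⟩
    convert ih (0 : E) using 1
    · funext n v; simp [Mesh.quot]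
    · funext z; simp

theorem SC.clm {k : ℕ} {f : ℕ → HexVertex → E} {φ : ℂ → E} (h : M.SC k f φ) (L : E →L[ℝ] F) :
    M.SC k (fun n v => L (f n v)) fun z => L (φ z) := by
  induction k generalizing f φ with
  | zero => exact ⟨L.contDiff.comp h.1, fun z₀ => (L.continuous.tendsto _).comp (h.2 z₀)⟩
  | succ k ih =>
    refine ⟨L.contDiff.comp h.1, fun z₀ => (L.continuous.tendsto _).comp (h.2.1 z₀), fun w => ?_⟩
    convert ih (h.2.2 w) using 1
    · funext n v; simp [Mesh.quot]
    · funext z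
      have := (L.hasFDerivAt.comp z (h.diff z).hasFDerivAt).fderiv
      rw [show (fun z => L (φ z)) = L ∘ φ from rfl, this]; rfl

theorem SC.add {k : ℕ} {f g : ℕ → HexVertex → E} {φ ψ : ℂ → E} (hf : M.SC k f φ)
    (hg : M.SC k g ψ) : M.SC k (fun n v => f n v + g n v) fun z => φ z + ψ z := by
  induction k generalizing f φ g ψ with
  | zero => exact ⟨hf.1.add hg.1, fun z₀ => (hf.2 z₀).add (hg.2 z₀)⟩
  | succ k ih =>
    refine ⟨hf.1.add hg.1, fun z₀ => (hf.2.1 z₀).add (hg.2.1 z₀), fun w => ?_⟩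
    convert ih (hf.2.2 w) (hg.2.2 w) using 1
    · funext n v; simp only [Mesh.quot, ← smul_add]; congr 1; abel
    · funext z; rw [((hf.diff z).hasFDerivAt.fun_add (hg.diff z).hasFDerivAt).fderiv]; rfl

theorem SC.neg {k : ℕ} {f : ℕ → HexVertex → E} {φ : ℂ → E} (hf : M.SC k f φ) :
    M.SC k (fun n v => -f n v) fun z => -φ z := by
  simpa using hf.clm (-ContinuousLinearMap.id ℝ E)

theorem SC.sub {k : ℕ} {f g : ℕ → HexVertex → E} {φ ψ : ℂ → E} (hf : M.SC k f φ)
    (hg : M.SC k g ψ) : M.SC k (fun n v => f n v - g n v) fun z => φ z - ψ z := by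
  simpa only [sub_eq_add_neg] using hf.add hg.neg

theorem SC.sum {ι : Type*} (s : Finset ι) {k : ℕ} {f : ι → ℕ → HexVertex → E} {φ : ι → ℂ → E}
    (h : ∀ i, M.SC k (f i) (φ i)) :
    M.SC k (fun n v => ∑ i ∈ s, f i n v) fun z => ∑ i ∈ s, φ i z := by
  classical
  induction s using Finset.induction_on with
  | empty => simpa using SC.const k (0 : E)
  | insert a s ha ih => simpa only [Finset.sum_insert ha] using (h a).add ih

/-- Discrete Leibniz rule: `D_w B(f, g) = B(D_w f, g(· + w)) + B(f, D_w g)`. The shift in the first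
summand is harmless by `SC.translate`. -/
theorem SC.bilin {k : ℕ} {f : ℕ → HexVertex → E} {φ : ℂ → E} {g : ℕ → HexVertex → F} {ψ : ℂ → F}
    (hf : M.SC k f φ) (hg : M.SC k g ψ) (B : E →L[ℝ] F →L[ℝ] G) :
    M.SC k (fun n v => B (f n v) (g n v)) fun z => B (φ z) (ψ z) := by
  have hc : ∀ {f : ℕ → HexVertex → E} {φ : ℂ → E} {g : ℕ → HexVertex → F} {ψ : ℂ → F},
      M.Conv f φ → M.Conv g ψ → M.Conv (fun n v => B (f n v) (g n v)) fun z => B (φ z) (ψ z) :=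
    fun hf hg z₀ => (B.isBoundedBilinearMap.continuous.tendsto (_, _)).comp
      ((hf z₀).prodMk_nhds (hg z₀))
  have hs : ContDiff ℝ ∞ fun z => B (φ z) (ψ z) :=
    (B.isBoundedBilinearMap.contDiff).comp (hf.smooth.prodMk hg.smooth)
  induction k generalizing f φ g ψ with
  | zero => exact ⟨hs, hc hf.2 hg.2⟩
  | succ k ih =>
    refine ⟨hs, hc hf.2.1 hg.2.1, fun w => ?_⟩
    have h₁ := ih (hf.2.2 w) (hg.of_succ.translate w)
      ((B.isBoundedBilinearMap.contDiff).comp ((hf.2.2 w).smooth.prodMk hg.smooth))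
    have h₂ := ih hf.of_succ (hg.2.2 w)
      ((B.isBoundedBilinearMap.contDiff).comp (hf.smooth.prodMk (hg.2.2 w).smooth))
    convert h₁.add h₂ using 1
    · funext n v
      simp only [Mesh.quot, map_smul, map_sub, smul_apply, sub_apply, ← smul_add]
      congr 1; abel
    · funext z
      rw [(B.hasFDerivAt_of_bilinear (hf.diff z).hasFDerivAt (hg.diff z).hasFDerivAt).fderiv]
      simp [add_comm]

theorem SC.mul {𝕜 : Type*} [RCLike 𝕜] {k : ℕ} {f g : ℕ → HexVertex → 𝕜} {φ ψ : ℂ → 𝕜}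
    (hf : M.SC k f φ) (hg : M.SC k g ψ) :
    M.SC k (fun n v => f n v * g n v) fun z => φ z * ψ z :=
  hf.bilin hg (ContinuousLinearMap.mul ℝ 𝕜)

theorem SC.smul {k : ℕ} {f : ℕ → HexVertex → ℝ} {φ : ℂ → ℝ} {g : ℕ → HexVertex → E} {ψ : ℂ → E}
    (hf : M.SC k f φ) (hg : M.SC k g ψ) :
    M.SC k (fun n v => f n v • g n v) fun z => φ z • ψ z :=
  hf.bilin hg (ContinuousLinearMap.lsmul ℝ ℝ)

theorem SC.inner {H : Type*} [NormedAddCommGroup H] [InnerProductSpace ℝ H] {k : ℕ}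
    {f g : ℕ → HexVertex → H} {φ ψ : ℂ → H} (hf : M.SC k f φ) (hg : M.SC k g ψ) :
    M.SC k (fun n v => inner ℝ (f n v) (g n v)) fun z => inner ℝ (φ z) (ψ z) :=
  hf.bilin hg (innerSL ℝ)

/-- Induction through `D_w (1 / f) = -(1 / f) (1 / f(· + w)) D_w f`, which holds only where `f` and
its translate are nonzero, hence eventually near each point. -/
theorem SC.inv {𝕜 : Type*} [RCLike 𝕜] {k : ℕ} {f : ℕ → HexVertex → 𝕜} {φ : ℂ → 𝕜}
    (hf : M.SC k f φ) (h0 : ∀ z, φ z ≠ 0) : M.SC k (fun n v => (f n v)⁻¹) fun z => (φ z)⁻¹ := by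
  induction k with
  | zero => exact ⟨hf.1.inv h0, fun z₀ => (hf.2 z₀).inv₀ (h0 z₀)⟩
  | succ k ih =>
    refine ⟨hf.1.inv h0, fun z₀ => (hf.2.1 z₀).inv₀ (h0 z₀), fun w => ?_⟩
    have hi := ih hf.of_succ
    have h := ((hi.mul (hi.translate w)).mul (hf.2.2 w)).neg
    refine SC.congr (h.congr_limit fun z => ?_) fun z₀ => ?_
    · have h1 := ((hasFDerivAt_inv (𝕜 := 𝕜) (h0 z)).restrictScalars ℝ).comp z
        (hf.diff z).hasFDerivAt
      have h2 := h1.fderiv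
      rw [show (fun z => (φ z)⁻¹) = (fun x => x⁻¹) ∘ φ from rfl, h2]
      simp
      ring
    · have h1 := (hf.2.1 z₀).eventually_ne (h0 z₀)
      filter_upwards [h1, (tendsto_shift (norm_z_translate w) z₀).eventually h1] with x hx hy
      simp only [Mesh.quot, RCLike.real_smul_eq_coe_mul]
      field_simp
      ring

/-- Induction through `D_w √f = D_w f / (√f + √f(· + w))`, valid where both values are positive. -/
theorem SC.sqrt {k : ℕ} {f : ℕ → HexVertex → ℝ} {φ : ℂ → ℝ}
    (hf : M.SC k f φ) (h0 : ∀ z, 0 < φ z) : M.SC k (fun n v => √(f n v)) fun z => √(φ z) := by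
  induction k with
  | zero =>
    exact ⟨hf.1.sqrt fun z => (h0 z).ne', fun z₀ => (Real.continuous_sqrt.tendsto _).comp (hf.2 z₀)⟩
  | succ k ih =>
    refine ⟨hf.1.sqrt fun z => (h0 z).ne',
      fun z₀ => (Real.continuous_sqrt.tendsto _).comp (hf.2.1 z₀), fun w => ?_⟩
    have hi := ih hf.of_succ
    have h := ((hi.add (hi.translate w)).inv
      (fun z => (add_pos (Real.sqrt_pos.2 (h0 z)) (Real.sqrt_pos.2 (h0 z))).ne')).mul (hf.2.2 w)
    refine SC.congr (h.congr_limit fun z => ?_) fun z₀ => ?_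
    · have h1 := ((hf.diff z).hasFDerivAt.sqrt (h0 z).ne').fderiv
      rw [h1, ← two_mul, one_div]
      rfl
    · have h1 := (hf.2.1 z₀).eventually_const_lt (h0 z₀)
      filter_upwards [h1, (tendsto_shift (norm_z_translate w) z₀).eventually h1] with x hx hy
      simp only [Mesh.quot, smul_eq_mul]
      have h3 := Real.sqrt_pos.2 hx
      have h4 := Real.sqrt_pos.2 hy
      have h5 := Real.sq_sqrt hx.le
      have h6 := Real.sq_sqrt hy.le
      rw [← mul_right_inj' (add_pos h3 h4).ne', mul_inv_cancel_left₀ (add_pos h3 h4).ne']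
      linear_combination (M.l x.1)⁻¹ * (h5 - h6)

/-- Periods preserve the colour, so a difference quotient never mixes the two formulas; only the
limits have to agree. -/
theorem SC.ite {k : ℕ} {f g : ℕ → HexVertex → E} {φ : ℂ → E} (hf : M.SC k f φ)
    (hg : M.SC k g φ) : M.SC k (fun n v => if v.white then f n v else g n v) φ := by
  have hc : ∀ {f g : ℕ → HexVertex → E} {φ : ℂ → E}, M.Conv f φ → M.Conv g φ →
      M.Conv (fun n v => if v.white then f n v else g n v) φ := fun hf hg z₀ =>
    Tendsto.if ((hf z₀).mono_left inf_le_left) ((hg z₀).mono_left inf_le_left)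
  induction k generalizing f g φ with
  | zero => exact ⟨hf.1, hc hf.2 hg.2⟩
  | succ k ih =>
    refine ⟨hf.1, hc hf.2.1 hg.2.1, fun w => ?_⟩
    convert ih (hf.2.2 w) (hg.2.2 w) using 1
    funext n v
    rcases v with ⟨a, b, _ | _⟩ <;> simp [Mesh.quot, DiscreteWeierstrass.translate]

/-- The colour sign has no limit of its own, but it may multiply anything that tends to zero. -/
theorem SC.sgn_smul {k : ℕ} {f : ℕ → HexVertex → E} (hf : M.SC k f fun _ => 0) :
    M.SC k (fun n v => sgn v • f n v) fun _ => 0 := by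
  have h : M.SC k (fun n v => -f n v) fun _ => 0 := by simpa using hf.neg
  convert h.ite hf using 1
  funext n v
  simp only [sgn]
  split_ifs <;> simp

theorem SC.l (k : ℕ) : M.SC k (fun n _ => M.l n) fun _ => 0 := by
  cases k with
  | zero => exact ⟨contDiff_const, tendsto_l⟩
  | succ k =>
    refine ⟨contDiff_const, tendsto_l, fun w => ?_⟩
    convert SC.const (M := M) k (0 : ℝ) using 1
    · funext n v; simp [Mesh.quot]
    · funext z; simp

end Mesh

/-! ### Locally uniform limits of entire functions -/

/-- Entire functions `F n` converging continuously, that is, locally uniformly, to `f`. -/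
structure EntireConv (F : ℕ → ℂ → ℂ) (f : ℂ → ℂ) : Prop where
  diff : ∀ n, Differentiable ℂ (F n)
  diff_lim : Differentiable ℂ f
  tendsto : ∀ z₀, Tendsto (fun x : ℕ × ℂ => F x.1 x.2) (atTop ×ˢ 𝓝 z₀) (𝓝 (f z₀))

namespace EntireConv

variable {F : ℕ → ℂ → ℂ} {f : ℂ → ℂ}

theorem const {f : ℂ → ℂ} (hf : Differentiable ℂ f) : EntireConv (fun _ => f) f :=
  ⟨fun _ => hf, hf, fun z₀ => (hf.continuous.tendsto z₀).comp tendsto_snd⟩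

theorem differentiable_deriv {f : ℂ → ℂ} (hf : Differentiable ℂ f) :
    Differentiable ℂ (deriv f) := by
  have h : ContDiff ℂ 2 f := hf.contDiff
  exact (contDiff_succ_iff_deriv.1 (show ContDiff ℂ (1 + 1) f from h)).2.2.differentiable
    one_ne_zero

/-- Weierstrass' theorem on locally uniform limits of holomorphic functions. -/
theorem deriv (h : EntireConv F f) : EntireConv (fun n => deriv (F n)) (deriv f) := by
  have h1 : TendstoLocallyUniformlyOn F f atTop Set.univ := by
    rw [tendstoLocallyUniformlyOn_univ, tendstoLocallyUniformly_iff_forall_tendsto]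
    intro z₀
    refine Filter.Tendsto.mono_right ?_ (nhds_le_uniformity (f z₀))
    exact ((h.diff_lim.continuous.tendsto z₀).comp tendsto_snd).prodMk_nhds (h.tendsto z₀)
  have h2 := h1.deriv (Eventually.of_forall fun n => (h.diff n).differentiableOn) isOpen_univ
  rw [tendstoLocallyUniformlyOn_univ, tendstoLocallyUniformly_iff_forall_tendsto] at h2
  refine ⟨fun n => differentiable_deriv (h.diff n), differentiable_deriv h.diff_lim,
    fun z₀ => ?_⟩
  have h3 := h2 z₀
  have h4 := ((differentiable_deriv h.diff_lim).continuous.tendsto z₀).comp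
    (tendsto_snd (f := (atTop : Filter ℕ)) (g := 𝓝 z₀))
  rw [Uniform.tendsto_nhds_right] at h4 ⊢
  exact Tendsto.uniformity_trans h4 h3

/-- Locally uniform strict differentiability. -/
theorem norm_sub_le (h : EntireConv F f) (z₀ : ℂ) {ε : ℝ} (hε : 0 < ε) :
    ∃ N : ℕ, ∃ δ > 0, ∀ n ≥ N, ∀ x ∈ Metric.ball z₀ δ, ∀ y ∈ Metric.ball z₀ δ,
      ‖F n y - F n x - (y - x) * _root_.deriv f z₀‖ ≤ ε * ‖y - x‖ := by
  have h1 := Metric.tendsto_nhds.1 (h.deriv.tendsto z₀) ε hε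
  obtain ⟨P, hP, Q, hQ, hPQ⟩ := Filter.eventually_prod_iff.1 h1
  obtain ⟨N, hN⟩ := eventually_atTop.1 hP
  obtain ⟨δ, hδ, hQ⟩ := Metric.eventually_nhds_iff_ball.1 hQ
  refine ⟨N, δ, hδ, fun n hn x hx y hy => ?_⟩
  have h2 := (convex_ball z₀ δ).norm_image_sub_le_of_norm_hasDerivWithin_le
    (f := fun y => F n y - y * _root_.deriv f z₀)
    (f' := fun y => _root_.deriv (F n) y - 1 * _root_.deriv f z₀) (C := ε)
    (fun w _ => ((h.diff n w).hasDerivAt.sub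
      ((hasDerivAt_id w).mul_const _)).hasDerivWithinAt)
    (fun w hw => by
      have := hPQ (hN n hn) (hQ w hw)
      rw [dist_eq_norm] at this
      simpa using this.le) hx hy
  refine (le_of_eq (congrArg norm ?_)).trans h2
  ring

/-- Mean value inequality for the remainder `g w - w g'(x) - (w - x)² g''(z₀) / 2`, whose derivative
is small by strict differentiability of `g'`. Both points vary, as uniformity over lattice points
requires. -/
theorem norm_taylor_le {g : ℂ → ℂ} (hg : Differentiable ℂ g) (z₀ : ℂ) {ε : ℝ} (hε : 0 < ε) :
    ∃ δ > 0, ∀ x ∈ Metric.ball z₀ δ, ∀ y ∈ Metric.ball z₀ δ,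
      ‖g y - g x - (y - x) * _root_.deriv g x
        - (y - x) ^ 2 * (_root_.deriv (_root_.deriv g) z₀ / 2)‖ ≤ ε * ‖y - x‖ ^ 2 := by
  obtain ⟨N, δ, hδ, H⟩ := (const hg).deriv.norm_sub_le z₀ hε
  refine ⟨δ, hδ, fun x hx y hy => ?_⟩
  -- Working on the segment instead of the ball gives `‖w - x‖ ≤ ‖y - x‖`, which supplies the second
  -- factor `‖y - x‖`.
  have hs : segment ℝ x y ⊆ Metric.ball z₀ δ := (convex_ball z₀ δ).segment_subset hx hy
  have h2 := (convex_segment (𝕜 := ℝ) x y).norm_image_sub_le_of_norm_hasDerivWithin_le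
    (f := fun w => g w - w * _root_.deriv g x - (w - x) ^ 2 * (_root_.deriv (_root_.deriv g) z₀ / 2))
    (f' := fun w => _root_.deriv g w - 1 * _root_.deriv g x -
      2 * (w - x) * (_root_.deriv (_root_.deriv g) z₀ / 2)) (C := ε * ‖y - x‖)
    (fun w _ => by
      have h3 := (((hasDerivAt_id w).sub_const x).pow 2).mul_const
        (_root_.deriv (_root_.deriv g) z₀ / 2)
      have h4 := ((hg w).hasDerivAt.sub ((hasDerivAt_id w).mul_const (_root_.deriv g x))).sub h3
      refine (h4.congr_deriv ?_).hasDerivWithinAt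
      simp)
    (fun w hw => by
      have h3 := H N le_rfl x hx w (hs hw)
      have h4 : ‖w - x‖ ≤ ‖y - x‖ := by
        obtain ⟨t, ⟨ht0, ht1⟩, rfl⟩ := (segment_eq_image' ℝ x y ▸ hw)
        simp only [add_sub_cancel_left, norm_smul, Real.norm_of_nonneg ht0]
        exact mul_le_of_le_one_left (norm_nonneg _) ht1
      refine le_trans (le_of_eq ?_) (h3.trans (mul_le_mul_of_nonneg_left h4 hε.le))
      congr 1; ring) (left_mem_segment ℝ x y) (right_mem_segment ℝ x y)
  rw [pow_two ‖y - x‖, ← mul_assoc]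
  refine (le_of_eq (congrArg norm ?_)).trans h2
  ring

variable {l : ℕ → ℝ}

theorem tendsto_add_mul (hl : Tendsto l atTop (𝓝 0)) (c z₀ : ℂ) :
    Tendsto (fun x : ℕ × ℂ => x.2 + l x.1 * c) (atTop ×ˢ 𝓝 z₀) (𝓝 z₀) := by
  have h1 : Tendsto (fun x : ℕ × ℂ => (l x.1 : ℂ)) (atTop ×ˢ 𝓝 z₀) (𝓝 0) := by
    rw [← ofReal_zero]
    exact ((continuous_ofReal.tendsto 0).comp hl).comp tendsto_fst
  simpa using tendsto_snd.add (h1.mul_const c)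

/-- The class is closed under difference quotients with step `l`; iteration yields every order at
once in `sc`. -/
theorem quot (h : EntireConv F f) (hp : ∀ n, 0 < l n) (hl : Tendsto l atTop (𝓝 0)) (c : ℂ) :
    EntireConv (fun n z => (l n : ℂ)⁻¹ * (F n (z + l n * c) - F n z))
      (fun z => c * _root_.deriv f z) := by
  refine ⟨fun n => ?_, (differentiable_deriv h.diff_lim).const_mul c, fun z₀ => ?_⟩
  · have := h.diff n
    fun_prop
  · rw [Metric.tendsto_nhds]
    intro ε hε
    have hε' : 0 < ε / (‖c‖ + 1) := by positivity
    obtain ⟨N, δ, hδ, H⟩ := h.norm_sub_le z₀ hε'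
    filter_upwards [tendsto_fst.eventually (eventually_ge_atTop N),
      tendsto_snd.eventually (Metric.ball_mem_nhds z₀ hδ),
      (tendsto_add_mul hl c z₀).eventually (Metric.ball_mem_nhds z₀ hδ)] with x h1 h2 h3
    have h4 := H x.1 h1 x.2 h2 _ h3
    have hl0 : (l x.1 : ℂ) ≠ 0 := ofReal_ne_zero.2 (hp _).ne'
    rw [dist_eq_norm, show (l x.1 : ℂ)⁻¹ * (F x.1 (x.2 + l x.1 * c) - F x.1 x.2)
      - c * _root_.deriv f z₀ = (l x.1 : ℂ)⁻¹ * (F x.1 (x.2 + l x.1 * c) - F x.1 x.2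
      - (x.2 + l x.1 * c - x.2) * _root_.deriv f z₀) by field_simp; ring, norm_mul, norm_inv,
      norm_real, Real.norm_of_nonneg (hp _).le, inv_mul_lt_iff₀ (hp _)]
    refine h4.trans_lt ?_
    rw [add_sub_cancel_left, norm_mul, norm_real, Real.norm_of_nonneg (hp _).le, div_mul_eq_mul_div,
      div_lt_iff₀ (by positivity)]
    nlinarith [mul_pos hε (hp x.1)]

/-- The second order term of `g` along an edge is itself a convergent entire family, so it can be
differenced to any order as well. -/
theorem taylor {g : ℂ → ℂ} (hg : Differentiable ℂ g) (hp : ∀ n, 0 < l n)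
    (hl : Tendsto l atTop (𝓝 0)) (c : ℂ) :
    EntireConv (fun n z => (l n : ℂ)⁻¹ *
      ((l n : ℂ)⁻¹ * (g (z + l n * c) - g z) - c * _root_.deriv g z))
      (fun z => c ^ 2 * (_root_.deriv (_root_.deriv g) z / 2)) := by
  have hg' := differentiable_deriv hg
  have hg'' := differentiable_deriv hg'
  refine ⟨fun n => by fun_prop, by fun_prop, fun z₀ => ?_⟩
  rw [Metric.tendsto_nhds]
  intro ε hε
  have hε' : 0 < ε / (‖c‖ ^ 2 + 1) := by positivity
  obtain ⟨δ, hδ, H⟩ := norm_taylor_le hg z₀ hε'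
  filter_upwards [tendsto_snd.eventually (Metric.ball_mem_nhds z₀ hδ),
    (tendsto_add_mul hl c z₀).eventually (Metric.ball_mem_nhds z₀ hδ)] with x h2 h3
  have h4 := H x.2 h2 _ h3
  have hl0 : (l x.1 : ℂ) ≠ 0 := ofReal_ne_zero.2 (hp _).ne'
  rw [dist_eq_norm, show (l x.1 : ℂ)⁻¹ *
      ((l x.1 : ℂ)⁻¹ * (g (x.2 + l x.1 * c) - g x.2) - c * _root_.deriv g x.2)
      - c ^ 2 * (_root_.deriv (_root_.deriv g) z₀ / 2) =
      ((l x.1 : ℂ) ^ 2)⁻¹ * (g (x.2 + l x.1 * c) - g x.2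
      - (x.2 + l x.1 * c - x.2) * _root_.deriv g x.2
      - (x.2 + l x.1 * c - x.2) ^ 2 * (_root_.deriv (_root_.deriv g) z₀ / 2)) by
        field_simp; ring, norm_mul, norm_inv, norm_pow,
    norm_real, Real.norm_of_nonneg (hp _).le, inv_mul_lt_iff₀ (pow_pos (hp _) 2)]
  refine h4.trans_lt ?_
  rw [add_sub_cancel_left, norm_mul, norm_real, Real.norm_of_nonneg (hp _).le, div_mul_eq_mul_div,
    div_lt_iff₀ (by positivity)]
  nlinarith [mul_pos hε (pow_pos (hp x.1) 2)]

theorem fderiv_real {f : ℂ → ℂ} (hf : Differentiable ℂ f) (z c : ℂ) :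
    fderiv ℝ f z c = c * _root_.deriv f z := by
  rw [((hf z).hasDerivAt.complexToReal_fderiv).fderiv]
  simp [mul_comm]

theorem sc {M : Mesh} (h : EntireConv F f) (k : ℕ) : M.SC k (fun n v => F n (M.z n v)) f := by
  have hc : ∀ {F : ℕ → ℂ → ℂ} {f : ℂ → ℂ}, EntireConv F f →
      M.Conv (fun n v => F n (M.z n v)) f := fun h z₀ =>
    (h.tendsto z₀).comp ((Mesh.tendsto_fst z₀).prodMk (Mesh.tendsto_z z₀))
  have hs : ∀ {f : ℂ → ℂ}, Differentiable ℂ f → ContDiff ℝ ∞ f := fun hf =>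
    hf.contDiff.restrict_scalars ℝ
  induction k generalizing F f with
  | zero => exact ⟨hs h.diff_lim, hc h⟩
  | succ k ih =>
    refine ⟨hs h.diff_lim, hc h, fun w => ?_⟩
    convert ih (h.quot M.l_pos M.l_lim (M.per w)) using 1
    · funext n v
      simp [Mesh.quot, Mesh.z_translate]
    · funext z
      exact fderiv_real h.diff_lim z _

end EntireConv

/-! ### Geometry of the hexagonal lattice -/

theorem omega_eq : omega = ⟨-1 / 2, √3 / 2⟩ := by
  have h : omega = exp ((2 * Real.pi / 3 : ℝ) * I) := by
    unfold omega; congr 1; push_cast; ring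
  have h1 : (2 * Real.pi / 3 : ℝ) = Real.pi - Real.pi / 3 := by ring
  rw [h, h1]
  apply Complex.ext
  · rw [exp_ofReal_mul_I_re, Real.cos_pi_sub, Real.cos_pi_div_three]; norm_num
  · rw [exp_ofReal_mul_I_im, Real.sin_pi_sub, Real.sin_pi_div_three]

theorem omega_sq : omega ^ 2 = -1 - omega := by
  rw [omega_eq, pow_two]
  apply Complex.ext
  · simp only [mul_re, sub_re, neg_re, one_re]
    nlinarith [Real.sq_sqrt (show (0 : ℝ) ≤ 3 by norm_num)]
  · simp only [mul_im, sub_im, neg_im, one_im]; ring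

theorem omega_cube : omega ^ 3 = 1 := by
  rw [pow_succ, omega_sq]; linear_combination -omega_sq

theorem norm_omega : ‖omega‖ = 1 := by
  have h := congrArg norm omega_cube
  rw [norm_pow, norm_one] at h
  exact (pow_eq_one_iff_of_nonneg (norm_nonneg _) three_ne_zero).1 h

theorem period_re (w : ℤ × ℤ) : (period w).re = 3 / 2 * (w.1 + w.2) := by
  rw [period, omega_sq, omega_eq]; simp; ring

theorem period_im (w : ℤ × ℤ) : (period w).im = √3 / 2 * (w.2 - w.1) := by
  rw [period, omega_sq, omega_eq]; simp; ring

theorem abs_le_norm_of_coord {a x y : ℝ} {c : ℂ} (hx : c.re = 3 / 2 * (x + y))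
    (hy : c.im = √3 / 2 * (y - x)) (ha : a = x ∨ a = y) : |a| ≤ ‖c‖ := by
  have h1 := Complex.abs_re_le_norm c
  have h2 := Complex.abs_im_le_norm c
  have h3 : (0 : ℝ) ≤ ‖c‖ := norm_nonneg _
  have h4 : c.re ^ 2 + c.im ^ 2 = ‖c‖ ^ 2 := by rw [← Complex.normSq_eq_norm_sq, normSq_apply]; ring
  have h5 := Real.sq_sqrt (show (0 : ℝ) ≤ 3 by norm_num)
  rw [hx, hy, mul_pow, mul_pow, div_pow √3, h5] at h4
  refine abs_le_of_sq_le_sq ?_ h3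
  rcases ha with rfl | rfl
  -- Here `‖c‖² = 3 (x² + x y + y²) = 3/4 (2 y + x)² + 9/4 x²`.
  · nlinarith [sq_nonneg (2 * y + a)]
  · nlinarith [sq_nonneg (2 * x + a)]

theorem abs_fst_le_norm_period (w : ℤ × ℤ) : |(w.1 : ℝ)| ≤ ‖period w‖ :=
  abs_le_norm_of_coord (period_re w) (period_im w) (Or.inl rfl)

theorem abs_snd_le_norm_period (w : ℤ × ℤ) : |(w.2 : ℝ)| ≤ ‖period w‖ :=
  abs_le_norm_of_coord (period_re w) (period_im w) (Or.inr rfl)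

theorem norm_period_le (w : ℤ × ℤ) : ‖period w‖ ≤ 2 * (|(w.1 : ℝ)| + |(w.2 : ℝ)|) := by
  have h1 : ‖(1 : ℂ) - omega‖ ≤ 2 := (norm_sub_le _ _).trans (by rw [norm_omega, norm_one]; norm_num)
  have h2 : ‖(1 : ℂ) - omega ^ 2‖ ≤ 2 :=
    (norm_sub_le _ _).trans (by rw [norm_pow, norm_omega, norm_one]; norm_num)
  refine (norm_add_le _ _).trans ?_
  rw [norm_mul, norm_mul, norm_intCast, norm_intCast]
  nlinarith [abs_nonneg (w.1 : ℝ), abs_nonneg (w.2 : ℝ)]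

/-- Rounding down the coordinates leaves fractional parts times two generators of norm at most 2,
whence the constant 4. -/
theorem exists_period_near (y : ℂ) : ∃ w, ‖period w - y‖ ≤ 4 := by
  obtain ⟨α, β, h⟩ : ∃ α β : ℝ, y = α * (1 - omega) + β * (1 - omega ^ 2) := by
    have h3 : √3 ≠ 0 := by positivity
    refine ⟨y.re / 3 - y.im / √3, y.re / 3 + y.im / √3, ?_⟩
    rw [omega_sq, omega_eq]
    apply Complex.ext
    · simp; ring
    · simp; field_simp; ring
  refine ⟨(⌊α⌋, ⌊β⌋), ?_⟩
  have h1 : ‖(1 : ℂ) - omega‖ ≤ 2 := (norm_sub_le _ _).trans (by rw [norm_omega, norm_one]; norm_num)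
  have h2 : ‖(1 : ℂ) - omega ^ 2‖ ≤ 2 :=
    (norm_sub_le _ _).trans (by rw [norm_pow, norm_omega, norm_one]; norm_num)
  have h3 : period (⌊α⌋, ⌊β⌋) - y
      = -((Int.fract α : ℝ) * (1 - omega) + (Int.fract β : ℝ) * (1 - omega ^ 2)) := by
    rw [h, Int.fract, Int.fract]; simp only [period]; push_cast; ring
  rw [h3, norm_neg]
  refine (norm_add_le _ _).trans ?_
  rw [norm_mul, norm_mul, norm_real, norm_real, Real.norm_of_nonneg (Int.fract_nonneg _),
    Real.norm_of_nonneg (Int.fract_nonneg _)]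
  nlinarith [Int.fract_nonneg α, Int.fract_nonneg β, Int.fract_lt_one α, Int.fract_lt_one β,
    norm_nonneg ((1 : ℂ) - omega), norm_nonneg ((1 : ℂ) - omega ^ 2)]

/-! ### Density of the vertices and uniformity on compact sets. -/

namespace Mesh

variable {E : Type*} [NormedAddCommGroup E] {M : Mesh}

theorem ζ_ne : M.ζ ≠ 0 := norm_ne_zero_iff.1 (by rw [M.norm_ζ]; exact one_ne_zero)

theorem exists_z_near (n : ℕ) (y : ℂ) : ∃ v, ‖M.z n v - y‖ ≤ 4 * M.l n := by
  have hl : (M.l n : ℂ) ≠ 0 := ofReal_ne_zero.2 (l_ne n)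
  obtain ⟨w, hw⟩ := exists_period_near ((y / M.l n - M.p) / M.ζ)
  refine ⟨⟨w.1, w.2, false⟩, ?_⟩
  have : M.z n ⟨w.1, w.2, false⟩ - y
      = M.l n * (M.ζ * (period w - (y / M.l n - M.p) / M.ζ)) := by
    have := ζ_ne (M := M)
    simp only [z, coord, pos]
    field_simp
    simp
    ring
  rw [this, norm_mul, norm_mul, M.norm_ζ, norm_real, Real.norm_of_nonneg (M.l_pos n).le]
  nlinarith [M.l_pos n]

instance near_neBot (z₀ : ℂ) : (M.near z₀).NeBot := by
  choose v hv using fun n => exists_z_near (M := M) n z₀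
  have h : Tendsto (fun n => (n, v n)) atTop (M.near z₀) := by
    refine tendsto_near tendsto_id ?_
    rw [tendsto_iff_norm_sub_tendsto_zero]
    exact squeeze_zero (fun _ => norm_nonneg _) hv (by simpa using M.l_lim.const_mul 4)
  exact h.neBot

theorem Conv.unique {f : ℕ → HexVertex → E} {φ ψ : ℂ → E} (h : M.Conv f φ) (h' : M.Conv f ψ) :
    φ = ψ := funext fun z₀ => tendsto_nhds_unique (h z₀) (h' z₀)

theorem eventually_near {z₀ : ℂ} {P : ℕ → HexVertex → Prop} :
    (∀ᶠ x in M.near z₀, P x.1 x.2) ↔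
      ∃ s ∈ 𝓝 z₀, ∀ᶠ n in atTop, ∀ v, M.z n v ∈ s → P n v := by
  constructor
  · intro h
    obtain ⟨A, ⟨a, ha, haA⟩, B, ⟨s, hs, hsB⟩, hAB⟩ := Filter.mem_inf_iff_superset.1 h
    refine ⟨s, hs, ?_⟩
    filter_upwards [ha] with n hn v hv
    exact hAB (a := (n, v)) ⟨haA hn, hsB hv⟩
  · rintro ⟨s, hs, h⟩
    filter_upwards [(tendsto_fst z₀).eventually h, (tendsto_z z₀).eventually hs] with x h1 h2
    exact h1 x.2 h2

/-- Finite subcover argument: local statements along `near` become uniform on compact sets. -/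
theorem eventually_of_compact {K : Set ℂ} (hK : IsCompact K) {P : ℕ → HexVertex → Prop}
    (h : ∀ z₀ ∈ K, ∀ᶠ x in M.near z₀, P x.1 x.2) :
    ∀ᶠ n in atTop, ∀ v, M.z n v ∈ K → P n v := by
  refine hK.induction_on (p := fun s => ∀ᶠ n in atTop, ∀ v, M.z n v ∈ s → P n v) ?_ ?_ ?_ ?_
  · simp
  · intro s t hst h
    filter_upwards [h] with n hn v hv using hn v (hst hv)
  · intro s t hs ht
    filter_upwards [hs, ht] with n h1 h2 v hv using hv.elim (h1 v) (h2 v)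
  · intro x hx
    obtain ⟨s, hs, h'⟩ := eventually_near.1 (h x hx)
    exact ⟨s, mem_nhdsWithin_of_mem_nhds hs, h'⟩

theorem Conv.uniform {f : ℕ → HexVertex → E} {φ : ℂ → E} (h : M.Conv f φ) (hφ : Continuous φ)
    {K : Set ℂ} (hK : IsCompact K) {ε : ℝ} (hε : 0 < ε) :
    ∀ᶠ n in atTop, ∀ v, M.z n v ∈ K → ‖f n v - φ (M.z n v)‖ < ε :=
  eventually_of_compact (P := fun n v => ‖f n v - φ (M.z n v)‖ < ε) hK fun z₀ _ => by
    have h1 := (h z₀).sub ((hφ.tendsto z₀).comp (tendsto_z z₀))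
    rw [sub_self] at h1
    simpa using Metric.tendsto_nhds.1 h1 ε hε

theorem conv_of_uniform {f : ℕ → HexVertex → E} {φ : ℂ → E} (hφ : Continuous φ)
    (h : ∀ K : Set ℂ, IsCompact K → ∀ ε > 0, ∀ᶠ n in atTop, ∀ v, M.z n v ∈ K →
      ‖f n v - φ (M.z n v)‖ < ε) : M.Conv f φ := fun z₀ => by
  have h1 : Tendsto (fun x : ℕ × HexVertex => f x.1 x.2 - φ (M.z x.1 x.2)) (M.near z₀) (𝓝 0) := by
    rw [Metric.tendsto_nhds]
    intro ε hε
    simp only [dist_zero_right]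
    exact eventually_near (P := fun n v => ‖f n v - φ (M.z n v)‖ < ε).2
      ⟨_, Metric.closedBall_mem_nhds z₀ one_pos, h _ (isCompact_closedBall z₀ 1) ε hε⟩
  simpa using h1.add ((hφ.tendsto z₀).comp (tendsto_z z₀))

theorem tendsto_near_fixed (u : HexVertex) :
    Tendsto (fun n => (n, u)) atTop (M.near 0) := by
  refine tendsto_near tendsto_id ?_
  have h1 : Tendsto (fun n => (M.l n : ℂ)) atTop (𝓝 0) := by
    rw [← ofReal_zero]; exact (continuous_ofReal.tendsto 0).comp M.l_lim
  simpa [z, coord] using h1.mul_const (M.p + M.ζ * pos u)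

theorem norm_int_path_le (φ : ℤ → E) (a : ℤ) {ε : ℝ}
    (h : ∀ i : ℤ, |i| ≤ |a| → ‖φ (i + 1) - φ i‖ ≤ ε) : ‖φ a - φ 0‖ ≤ |(a : ℝ)| * ε := by
  obtain ⟨n, rfl | rfl⟩ := Int.eq_nat_or_neg a
  · have : ∀ m : ℕ, m ≤ n → ‖φ m - φ 0‖ ≤ m * ε := by
      intro m
      induction m with
      | zero => simp
      | succ m ih =>
        intro hm
        have h1 := h m (by rw [Nat.abs_cast, Nat.abs_cast]; omega)
        have h2 := norm_add_le (φ (m + 1) - φ m) (φ m - φ 0)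
        rw [sub_add_sub_cancel] at h2
        push_cast
        nlinarith [ih (by omega)]
    simpa using this n le_rfl
  · have : ∀ m : ℕ, m ≤ n → ‖φ (-m) - φ 0‖ ≤ m * ε := by
      intro m
      induction m with
      | zero => simp
      | succ m ih =>
        intro hm
        have h1 := h (-(m + 1)) (by rw [abs_neg, abs_neg, Nat.abs_cast, abs_of_nonneg (by omega)]; omega)
        rw [show (-(m + 1) + 1 : ℤ) = -m by ring, norm_sub_rev] at h1
        have h2 := norm_add_le (φ (-(m + 1)) - φ (-m)) (φ (-m) - φ 0)
        rw [sub_add_sub_cancel] at h2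
        push_cast
        nlinarith [ih (by omega)]
    simpa using this n le_rfl

/-- Continuous convergence implies convergence of the images of closed discs. -/
theorem Conv.hausdorff {f : ℕ → HexVertex → E} {φ : ℂ → E} (h : M.Conv f φ) (hφ : Continuous φ)
    (c : ℂ) {R : ℝ} (hR : 0 < R) :
    Tendsto (fun n => Metric.hausdorffEDist (f n '' {v | M.z n v ∈ Metric.closedBall c R})
      (φ '' Metric.closedBall c R)) atTop (𝓝 0) := by
  rw [ENNReal.tendsto_nhds_zero]
  intro ε hε
  obtain ⟨r, hr, hrε⟩ : ∃ r : ℝ, 0 < r ∧ ENNReal.ofReal r ≤ ε := by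
    rcases eq_or_ne ε ⊤ with rfl | hne
    · exact ⟨1, one_pos, le_top⟩
    · exact ⟨ε.toReal, ENNReal.toReal_pos hε.ne' hne, (ENNReal.ofReal_toReal hne).le⟩
  have hB := isCompact_closedBall c R
  obtain ⟨δ, hδ, hδφ⟩ := Metric.uniformContinuousOn_iff.1
    (hB.uniformContinuousOn_of_continuous hφ.continuousOn) (r / 2) (half_pos hr)
  -- A point near the boundary is first moved towards the centre by the factor `1 - t`. A vertex
  -- within `4 l < t R` of the moved point then lies in the disc, at distance less than `2 t R ≤ δ /
  -- 2` from the original point.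
  set t := min 1 (δ / (4 * R)) with ht
  have ht0 : 0 < t := by positivity
  have ht1 : t ≤ 1 := min_le_left _ _
  have htδ : t * R ≤ δ / 4 := by
    calc t * R ≤ δ / (4 * R) * R := mul_le_mul_of_nonneg_right (min_le_right _ _) hR.le
      _ = δ / 4 := by field_simp
  have hl := M.l_lim.eventually_lt_const (show (0 : ℝ) < t * R / 4 by positivity)
  filter_upwards [h.uniform hφ hB (half_pos hr), hl] with n hn hln
  refine (Metric.hausdorffEDist_le_of_mem_edist ?_ ?_).trans hrε
  · rintro _ ⟨v, hv, rfl⟩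
    refine ⟨_, ⟨_, hv, rfl⟩, ?_⟩
    rw [edist_dist, dist_eq_norm]
    exact ENNReal.ofReal_le_ofReal ((hn v hv).le.trans (by linarith))
  · rintro _ ⟨y, hy, rfl⟩
    obtain ⟨v, hv⟩ := exists_z_near (M := M) n (c + (1 - t) * (y - c))
    rw [Metric.mem_closedBall, dist_eq_norm] at hy
    have h1 : ‖((1 - t : ℝ) : ℂ) * (y - c)‖ ≤ (1 - t) * R := by
      rw [norm_mul, norm_real, Real.norm_of_nonneg (by linarith)]
      exact mul_le_mul_of_nonneg_left hy (by linarith)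
    have h1' : ‖((t : ℝ) : ℂ) * (y - c)‖ ≤ t * R := by
      rw [norm_mul, norm_real, Real.norm_of_nonneg ht0.le]
      exact mul_le_mul_of_nonneg_left hy ht0.le
    have hvB : M.z n v ∈ Metric.closedBall c R := by
      rw [Metric.mem_closedBall, dist_eq_norm]
      have h2 : M.z n v - c = (M.z n v - (c + (1 - t) * (y - c))) + ((1 - t : ℝ) : ℂ) * (y - c) := by
        push_cast; ring
      rw [h2]
      refine (norm_add_le _ _).trans ?_
      linarith
    refine ⟨_, ⟨v, hvB, rfl⟩, ?_⟩
    have h3 : dist y (M.z n v) < δ := by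
      rw [dist_comm, dist_eq_norm]
      have h2 : M.z n v - y = (M.z n v - (c + (1 - t) * (y - c))) - (t : ℂ) * (y - c) := by ring
      rw [h2]
      refine (norm_sub_le _ _).trans_lt ?_
      linarith
    have h4 := hδφ y (by rwa [Metric.mem_closedBall, dist_eq_norm]) _ hvB h3
    have h5 := hn v hvB
    rw [← dist_eq_norm, dist_comm] at h5
    rw [edist_dist]
    refine ENNReal.ofReal_le_ofReal ((dist_triangle _ (φ (M.z n v)) _).trans ?_)
    linarith

/-! ### From difference quotients to convergence. -/

variable [NormedSpace ℝ E]

theorem norm_per (w : ℤ × ℤ) : ‖M.per w‖ = ‖period w‖ := by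
  rw [per, norm_mul, M.norm_ζ, one_mul]

/-- A lattice function which tends to zero at a black and at a white vertex and whose difference
quotients tend to zero tends to zero. -/
theorem conv_zero_of_quot {f : ℕ → HexVertex → E}
    (h₁ : M.Conv (M.quot (1, 0) f) fun _ => 0) (h₂ : M.Conv (M.quot (0, 1) f) fun _ => 0)
    (hb : ∀ b, ∃ u : HexVertex, u.white = b ∧ Tendsto (fun n => f n u) atTop (𝓝 0)) :
    M.Conv f fun _ => 0 := by
  refine conv_of_uniform continuous_const fun K hK ε hε => ?_
  obtain ⟨R, hR0, hR⟩ := hK.isBounded.exists_pos_norm_le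
  choose u hu hfu using hb
  -- Every vertex is reached from a base vertex of its colour by two straight runs of periods. Each
  -- run has at most `(R + 1) / l` steps and so contributes at most `ε / 4`; the base value
  -- contributes less than `ε / 2`.
  have hε' : 0 < ε / (4 * (R + 1)) := by positivity
  -- This disc contains both runs: the base vertex has norm below 1, and by `norm_period_le` the
  -- displacement is at most `2 (l |a| + l |c|)`.
  have hK' := isCompact_closedBall (0 : ℂ) (1 + 4 * (R + 1))
  have hbase : ∀ b, ∀ᶠ n in atTop, ‖f n (u b)‖ < ε / 2 ∧ ‖M.z n (u b)‖ < 1 := fun b => by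
    have h3 := Metric.tendsto_nhds.1 (hfu b) _ (half_pos hε)
    have h4 := Metric.tendsto_nhds.1 ((tendsto_z (M := M) 0).comp (tendsto_near_fixed (u b))) 1 one_pos
    filter_upwards [h3, h4] with n h5 h6
    exact ⟨by simpa using h5, by simpa using h6⟩
  filter_upwards [h₁.uniform continuous_const hK' hε', h₂.uniform continuous_const hK' hε',
    hbase false, hbase true] with n H₁ H₂ hF hT v hv
  have hl := M.l_pos n
  obtain ⟨s, hs, hb1, hb2⟩ : ∃ s, s.white = v.white ∧ ‖f n s‖ < ε / 2 ∧ ‖M.z n s‖ < 1 := by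
    refine ⟨_, hu v.white, ?_⟩
    cases v.white
    · exact hF
    · exact hT
  obtain ⟨a, c, rfl⟩ : ∃ a c : ℤ, v = translate (translate s (a, 0)) (0, c) := by
    refine ⟨v.m - s.m, v.n - s.n, ?_⟩
    rcases v with ⟨m, k, b⟩
    simp only [DiscreteWeierstrass.translate, HexVertex.mk.injEq]
    exact ⟨by ring, by ring, hs.symm⟩
  have hz : M.l n * ‖period (a, c)‖ ≤ R + 1 := by
    have h3 := hR _ hv
    have h4 : M.z n (translate (translate s (a, 0)) (0, c)) - M.z n s
        = M.l n * M.per (a, c) := by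
      rw [z_translate, z_translate]
      simp only [per, period]; push_cast; ring
    have h5 := norm_sub_le (M.z n (translate (translate s (a, 0)) (0, c))) (M.z n s)
    rw [h4, norm_mul, norm_real, Real.norm_of_nonneg hl.le, norm_per] at h5
    linarith
  have ha : M.l n * |(a : ℝ)| ≤ R + 1 :=
    (mul_le_mul_of_nonneg_left (abs_fst_le_norm_period (a, c)) hl.le).trans hz
  have hc : M.l n * |(c : ℝ)| ≤ R + 1 :=
    (mul_le_mul_of_nonneg_left (abs_snd_le_norm_period (a, c)) hl.le).trans hz
  have hstep : ∀ (e : ℤ × ℤ) (y : HexVertex), ‖M.quot e f n y - 0‖ < ε / (4 * (R + 1)) →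
      ‖f n (translate y e) - f n y‖ ≤ M.l n * (ε / (4 * (R + 1))) := fun e y h => by
    rw [sub_zero, Mesh.quot, norm_smul, norm_inv, Real.norm_of_nonneg hl.le,
      inv_mul_lt_iff₀ hl] at h
    exact h.le
  have hin : ∀ i k : ℤ, |i| ≤ |a| → |k| ≤ |c| →
      M.z n (translate (translate s (i, 0)) (0, k)) ∈ Metric.closedBall 0 (1 + 4 * (R + 1)) := by
    intro i k hi hk
    have h4 : M.z n (translate (translate s (i, 0)) (0, k)) = M.z n s
        + M.l n * M.per (i, k) := by
      rw [z_translate, z_translate]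
      simp only [per, period]; push_cast; ring
    have h6 : |(i : ℝ)| ≤ |(a : ℝ)| := by exact_mod_cast hi
    have h7 : |(k : ℝ)| ≤ |(c : ℝ)| := by exact_mod_cast hk
    have h8 := norm_period_le (i, k)
    rw [mem_closedBall_zero_iff, h4]
    refine (norm_add_le _ _).trans ?_
    rw [norm_mul, norm_real, Real.norm_of_nonneg hl.le, norm_per]
    simp only at h8
    have := mul_le_mul_of_nonneg_left h8 hl.le
    have := mul_le_mul_of_nonneg_left h6 hl.le
    have := mul_le_mul_of_nonneg_left h7 hl.le
    linarith
  have e1 : ∀ y : HexVertex, ∀ i j : ℤ, translate (translate y (i, 0)) (j, 0)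
      = translate y (i + j, 0) := fun y i j => by
    simp [DiscreteWeierstrass.translate]; ring
  have e2 : ∀ y : HexVertex, ∀ i j : ℤ, translate (translate y (0, i)) (0, j)
      = translate y (0, i + j) := fun y i j => by
    simp [DiscreteWeierstrass.translate]; ring
  have e0 : ∀ y : HexVertex, translate y (0, 0) = y := fun y => by
    simp [DiscreteWeierstrass.translate]
  have p1 := norm_int_path_le (fun i => f n (translate s (i, 0))) a
    (ε := M.l n * (ε / (4 * (R + 1)))) fun i hi => by
      have := hstep (1, 0) _ (H₁ _ (hin i 0 hi (by simp)))
      simpa only [e0, e1] using this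
  have p2 := norm_int_path_le (fun i => f n (translate (translate s (a, 0)) (0, i))) c
    (ε := M.l n * (ε / (4 * (R + 1)))) fun i hi => by
      have := hstep (0, 1) _ (H₂ _ (hin a i le_rfl hi))
      simpa only [e2] using this
  simp only [e0] at p1 p2
  have q : ∀ x : ℝ, M.l n * x ≤ R + 1 → x * (M.l n * (ε / (4 * (R + 1)))) ≤ ε / 4 := fun x hx => by
    calc x * (M.l n * (ε / (4 * (R + 1)))) = (M.l n * x) * (ε / (4 * (R + 1))) := by ring
      _ ≤ (R + 1) * (ε / (4 * (R + 1))) := mul_le_mul_of_nonneg_right hx hε'.le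
      _ = ε / 4 := by field_simp
  have q1 := p1.trans (q _ ha)
  have q2 := p2.trans (q _ hc)
  rw [sub_zero]
  calc ‖f n (translate (translate s (a, 0)) (0, c))‖
      = ‖(f n (translate (translate s (a, 0)) (0, c)) - f n (translate s (a, 0)))
        + (f n (translate s (a, 0)) - f n s) + f n s‖ := by congr 1; abel
    _ ≤ _ := norm_add₃_le
    _ < ε := by linarith

/-- If the difference quotients along generators of the lattice of periods tend to zero, then all
of them do. -/
theorem sc_quot_zero {k : ℕ} {f : ℕ → HexVertex → E}
    (h₁ : M.SC k (M.quot (-1, 0) f) fun _ => 0) (h₂ : M.SC k (M.quot (0, -1) f) fun _ => 0)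
    (w : ℤ × ℤ) : M.SC k (M.quot w f) fun _ => 0 := by
  -- The periods with vanishing limit form a subgroup, since `D_{a+b} f = (D_a f)(· + b) + D_b f`
  -- and `D_{-a} f = -(D_a f)(· - a)`.
  let S : AddSubgroup (ℤ × ℤ) :=
    { carrier := {w | M.SC k (M.quot w f) fun _ => 0}
      zero_mem' := by
        change M.SC k _ _
        convert SC.const (M := M) k (0 : E) using 1
        funext n v
        simp [Mesh.quot, DiscreteWeierstrass.translate]
      add_mem' := fun {a b} ha hb => by
        change M.SC k _ _
        have := (SC.translate ha b).add hb
        simp only [add_zero] at this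
        convert this using 1
        funext n v
        simp only [Mesh.quot, ← smul_add]
        congr 1
        simp only [DiscreteWeierstrass.translate, Prod.fst_add, Prod.snd_add, add_comm a.1,
          add_comm a.2, add_assoc]
        abel
      neg_mem' := fun {a} ha => by
        change M.SC k _ _
        have := (SC.translate ha (-a)).neg
        simp only [neg_zero] at this
        convert this using 1
        funext n v
        simp [Mesh.quot, ← smul_neg, DiscreteWeierstrass.translate] }
  have h : w = (-w.1) • ((-1, 0) : ℤ × ℤ) + (-w.2) • ((0, -1) : ℤ × ℤ) := by
    ext <;> simp
  change w ∈ S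
  rw [h]
  exact S.add_mem (S.zsmul_mem h₁ _) (S.zsmul_mem h₂ _)

/-- All orders are assumed together because each period in the list consumes one of them. -/
theorem SC.smoothlyConvergesOn {f : ℕ → HexVertex → E} {φ : ℂ → E} (h : ∀ k, M.SC k f φ)
    (U : Set ℂ) : SmoothlyConvergesOn M.p M.ζ M.l f φ U := by
  have key : ∀ ws : List (ℤ × ℤ), ∀ k, M.SC k (fun n => iterDiff (M.l n) (f n) ws)
      (fun z => iteratedFDeriv ℝ ws.length φ z fun i => M.per (ws.get i)) := by
    intro ws
    induction ws with
    | nil => exact h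
    | cons w ws ih =>
      intro k
      refine ((ih (k + 1)).quot w).congr_limit fun z => ?_
      have hd : DifferentiableAt ℝ (iteratedFDeriv ℝ ws.length φ) z :=
        ((h 0).smooth.differentiable_iteratedFDeriv (by exact_mod_cast WithTop.coe_lt_top _)) z
      change _ = iteratedFDeriv ℝ (ws.length + 1) φ z fun i => M.per ((w :: ws).get i)
      rw [iteratedFDeriv_succ_apply_left]
      have h1 := hd.hasFDerivAt.continuousMultilinear_apply_const (u := fun i => M.per (ws.get i))
      rw [h1.fderiv]
      rfl
  intro K hK _ ws ε hε
  exact (key ws 0).conv.uniform (key ws 0).smooth.continuous hK hε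

end Mesh

/-! ### Rigidity of discrete holomorphic quadratic differentials -/

theorem sgn_mul_self (v : HexVertex) : sgn v * sgn v = 1 := by
  simp only [sgn]; split_ifs <;> norm_num

theorem sgn_mul_self_complex (v : HexVertex) : (sgn v : ℂ) * sgn v = 1 := by
  exact_mod_cast sgn_mul_self v

theorem omega_pow_add_one (j : Fin 3) :
    omega ^ ((j + 1 : Fin 3) : ℕ) = omega * omega ^ (j : ℕ) := by
  fin_cases j
  · simp
  · simp [pow_two]
  · simpa [← pow_succ'] using omega_cube.symm

theorem omega_pow_add_two (j : Fin 3) :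
    omega ^ ((j + 2 : Fin 3) : ℕ) = omega ^ 2 * omega ^ (j : ℕ) := by
  rw [show j + 2 = j + 1 + 1 by rw [add_assoc]; rfl, omega_pow_add_one, omega_pow_add_one]; ring

theorem sum_fin_three_shift {E : Type*} [AddCommMonoid E] (f : Fin 3 → E) (j : Fin 3) :
    ∑ i, f i = f j + f (j + 1) + f (j + 2) := by
  rw [← Equiv.sum_comp (Equiv.addLeft j) f, Fin.sum_univ_three]
  simp

/-! ### Divided differences of `g` along edges. -/

namespace Mesh

variable (M : Mesh)

/-- The direction of the edges number `j` emerging from black vertices. -/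
def dir (j : Fin 3) : ℂ := M.ζ * omega ^ (j : ℕ)

/-- The difference of `g` along an edge, divided by the signed length of the edge. -/
def slope (g : ℂ → ℂ) (j : Fin 3) (n : ℕ) (v : HexVertex) : ℂ :=
  sgn v * ((M.l n : ℂ)⁻¹ * dAlong g (M.z n) v j)

/-- The second order term of `slope`. -/
def slopeRem (g : ℂ → ℂ) (j : Fin 3) (n : ℕ) (v : HexVertex) : ℂ :=
  sgn v * ((M.l n : ℂ)⁻¹ * (M.slope g j n v - M.dir j * deriv g (M.z n v)))

/-- The coefficient of a quadratic differential with respect to `dz²`. -/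
def coeff (qd : ℕ → HexVertex → Fin 3 → ℂ) (j : Fin 3) (n : ℕ) (v : HexVertex) : ℂ :=
  qd n v j / (M.z n (nbr v j) - M.z n v) ^ 2

variable {M} {g q : ℂ → ℂ} {qd : ℕ → HexVertex → Fin 3 → ℂ}

theorem dir_ne (j : Fin 3) : M.dir j ≠ 0 :=
  mul_ne_zero ζ_ne (pow_ne_zero _ (norm_ne_zero_iff.1 (by rw [norm_omega]; exact one_ne_zero)))

theorem dir_add_one (j : Fin 3) : M.dir (j + 1) = omega * M.dir j := by
  rw [dir, omega_pow_add_one, dir]; ring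

theorem dir_add_two (j : Fin 3) : M.dir (j + 2) = omega ^ 2 * M.dir j := by
  rw [dir, omega_pow_add_two, dir]; ring

theorem z_nbr_sub (n : ℕ) (v : HexVertex) (j : Fin 3) :
    M.z n (nbr v j) - M.z n v = M.l n * (sgn v * M.dir j) := by
  rw [z_nbr, dir]; ring

theorem l_ne_complex (n : ℕ) : (M.l n : ℂ) ≠ 0 := ofReal_ne_zero.2 (l_ne n)

/-- Edges at white vertices point along `-dir j`; dividing by the signed length makes the limits for
the two colours agree, as `SC.ite` requires. -/
theorem slope_sc (hg : Differentiable ℂ g) (j : Fin 3) (k : ℕ) :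
    M.SC k (M.slope g j) fun z => M.dir j * deriv g z := by
  have h : ∀ c, M.SC k _ _ := fun c =>
    ((EntireConv.const hg).quot M.l_pos M.l_lim c).sc (M := M) k
  have hw := (h (-M.dir j)).neg.congr_limit (ψ := fun z => M.dir j * deriv g z) fun z => by ring
  convert hw.ite (h (M.dir j)) using 1
  funext n v
  simp only [slope, dAlong, z_nbr, sgn, dir]
  split_ifs <;> simp

theorem slopeRem_sc (hg : Differentiable ℂ g) (j : Fin 3) (k : ℕ) :
    M.SC k (M.slopeRem g j) fun z => M.dir j ^ 2 * (deriv (deriv g) z / 2) := by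
  have h : ∀ c, M.SC k _ _ := fun c =>
    (EntireConv.taylor hg M.l_pos M.l_lim c).sc (M := M) k
  have hw := (h (-M.dir j)).congr_limit
    (ψ := fun z => M.dir j ^ 2 * (deriv (deriv g) z / 2)) fun z => by ring
  convert hw.ite (h (M.dir j)) using 1
  funext n v
  simp only [slopeRem, slope, dAlong, z_nbr, sgn, dir]
  split_ifs
  · simp; ring
  · simp

theorem dAlong_eq (g : ℂ → ℂ) (n : ℕ) (v : HexVertex) (j : Fin 3) :
    dAlong g (M.z n) v j = M.l n * (sgn v * M.slope g j n v) := by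
  have := l_ne_complex (M := M) n
  have h := sgn_mul_self_complex v
  rw [slope, ← mul_assoc (sgn v : ℂ), h]
  field_simp

theorem slope_eq (g : ℂ → ℂ) (n : ℕ) (v : HexVertex) (j : Fin 3) :
    M.slope g j n v = M.dir j * deriv g (M.z n v) + M.l n * (sgn v * M.slopeRem g j n v) := by
  have := l_ne_complex (M := M) n
  have h := sgn_mul_self_complex v
  rw [slopeRem, ← mul_assoc (sgn v : ℂ), h]
  field_simp
  ring

theorem slope_ne {n : ℕ} (hnd : NonDegenerate g (M.z n)) (v : HexVertex) (j : Fin 3) :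
    M.slope g j n v ≠ 0 := by
  intro h
  have := dAlong_eq (M := M) g n v j
  rw [h, mul_zero, mul_zero, dAlong, sub_eq_zero] at this
  exact hnd v j this

theorem qd_eq (qd : ℕ → HexVertex → Fin 3 → ℂ) (n : ℕ) (v : HexVertex) (j : Fin 3) :
    qd n v j = M.l n ^ 2 * (M.dir j ^ 2 * M.coeff qd j n v) := by
  have h1 := l_ne_complex (M := M) n
  have h2 := dir_ne (M := M) j
  have h := sgn_mul_self_complex v
  have h3 : (sgn v : ℂ) ≠ 0 := left_ne_zero_of_mul_eq_one h
  rw [coeff, z_nbr_sub]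
  field_simp
  rw [pow_two, h, mul_one]

/-- This is the vanishing of `∑ τ`, conjugated and freed from the constant `I`; conjugates do not
occur after this point in the vertex equations. -/
theorem sum_div_dAlong {z : HexVertex → ℂ} {q : HexVertex → Fin 3 → ℂ}
    (h : IsHolomorphicQuadraticDifferential g z q) (v : HexVertex) :
    ∑ j, q v j / dAlong g z v j = 0 := by
  have h1 := congrArg (starRingEnd ℂ) (h.sum_tau v)
  simp only [tau, map_sum, conj_conj, map_zero] at h1
  have h2 : ∀ j, q v j / dAlong g z v j = I * (q v j / (I * dAlong g z v j)) := fun j => by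
    rw [← mul_div_assoc, mul_div_mul_left _ _ I_ne_zero]
  rw [Finset.sum_congr rfl fun j _ => h2 j, ← Finset.mul_sum, h1, mul_zero]

/-- With coefficients `cᵢ` and slopes `sᵢ` the two vertex equations are `∑ ω²ⁱ cᵢ = 0` and `∑ ω²ⁱ cᵢ
/ sᵢ = 0`; the third coefficient is eliminated. -/
theorem coeff_relation {n : ℕ} (hnd : NonDegenerate g (M.z n))
    (hq : IsHolomorphicQuadraticDifferential g (M.z n) (qd n)) (v : HexVertex) (j : Fin 3) :
    M.coeff qd j n v * ((M.slope g (j + 2) n v - M.slope g j n v) * M.slope g (j + 1) n v) =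
      M.coeff qd (j + 1) n v *
        (omega ^ 2 * (M.slope g (j + 1) n v - M.slope g (j + 2) n v) * M.slope g j n v) := by
  have h1 := hq.sum_q v
  have h2 := sum_div_dAlong hq v
  rw [sum_fin_three_shift _ j] at h1 h2
  have hl := l_ne_complex (M := M) n
  have hs : (sgn v : ℂ) ≠ 0 := left_ne_zero_of_mul_eq_one (sgn_mul_self_complex v)
  have e0 := slope_ne hnd v j
  have e1 := slope_ne hnd v (j + 1)
  have e2 := slope_ne hnd v (j + 2)
  have hd := dir_ne (M := M) j
  simp only [qd_eq (M := M), dAlong_eq, dir_add_one, dir_add_two] at h1 h2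
  have h1' : M.coeff qd j n v + omega ^ 2 * M.coeff qd (j + 1) n v
      + omega ^ 4 * M.coeff qd (j + 2) n v = 0 := by
    have : (M.l n : ℂ) ^ 2 * M.dir j ^ 2 ≠ 0 := by positivity
    apply (mul_eq_zero_iff_left this).1
    linear_combination h1
  have h2' : M.coeff qd j n v / M.slope g j n v + omega ^ 2 * M.coeff qd (j + 1) n v
      / M.slope g (j + 1) n v + omega ^ 4 * M.coeff qd (j + 2) n v / M.slope g (j + 2) n v = 0 := by
    have : (M.l n : ℂ) * M.dir j ^ 2 / sgn v ≠ 0 := div_ne_zero (by positivity) hs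
    apply (mul_eq_zero_iff_left this).1
    rw [← h2]
    field_simp
  field_simp at h2'
  linear_combination h2' - M.slope g j n v * M.slope g (j + 1) n v * h1'

/-- The relative difference of the coefficients along two edges at a vertex is of order `o(l)`. -/
theorem defect_sc (hg : Differentiable ℂ g) (j : Fin 3) (k : ℕ) :
    M.SC k (fun n v => (M.l n : ℂ)⁻¹ *
      ((M.slope g (j + 2) n v - M.slope g j n v) * M.slope g (j + 1) n v -
        omega ^ 2 * (M.slope g (j + 1) n v - M.slope g (j + 2) n v) * M.slope g j n v))
      fun _ => 0 := by
  have s0 := slopeRem_sc (M := M) hg j k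
  have s1 := slopeRem_sc (M := M) hg (j + 1) k
  have s2 := slopeRem_sc (M := M) hg (j + 2) k
  have u := (SC.const (M := M) k (M.dir j)).mul
    ((EntireConv.const (EntireConv.differentiable_deriv hg)).sc (M := M) k)
  have c := fun a : ℂ => SC.const (M := M) k a
  -- Write `sᵢ = ωⁱ u ± l rᵢ`. The order 0 part of the defect is `(ω⁴ - ω) u² = 0`, `± u * p1` is
  -- the coefficient of `l`, and `p2` that of `l²`. In the limit `rᵢ` is proportional to `ω²ⁱ`, and
  -- `p1` vanishes as well because `ω³ = 1`.
  have p1 := (((s2.sub s0).mul (c omega)).add ((c (omega ^ 2 - 1)).mul s1)).add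
    ((c (omega ^ 2)).mul ((s2.sub s1).add ((c (omega ^ 2 - omega)).mul s0)))
  have p2 := ((s2.sub s0).mul s1).add ((c (omega ^ 2)).mul ((s2.sub s1).mul s0))
  have p1' := (u.mul p1).congr_limit (ψ := fun _ => 0) fun z => by
    rw [dir_add_one, dir_add_two]
    linear_combination (M.dir j ^ 3 * deriv g z * (deriv (deriv g) z / 2)) *
      (omega + omega ^ 2 + omega ^ 3) * omega_cube
  have p2' := ((SC.l (M := M) k).smul p2).congr_limit (ψ := fun _ => 0) fun z => by simp
  have key := (p1'.sgn_smul.add p2').congr_limit (ψ := fun _ => 0) fun z => by simp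
  refine key.congr fun z₀ => Eventually.of_forall fun ⟨n, v⟩ => ?_
  have hl := l_ne_complex (M := M) n
  have h := sgn_mul_self_complex v
  simp only [slope_eq, dir_add_one, dir_add_two, real_smul]
  rw [eq_inv_mul_iff_mul_eq₀ hl]
  generalize M.slopeRem g j n v = r₀, M.slopeRem g (j + 1) n v = r₁,
    M.slopeRem g (j + 2) n v = r₂
  linear_combination (-(M.l n : ℂ) ^ 2 * ((r₂ - r₀) * r₁ + omega ^ 2 * ((r₂ - r₁) * r₀))) * h -
    omega * (M.dir j * deriv g (M.z n v)) ^ 2 * omega_cube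

/-- Difference of the coefficients along two edges emerging from a vertex. -/
def edgeDiff (M : Mesh) (qd : ℕ → HexVertex → Fin 3 → ℂ) (i j : Fin 3) (n : ℕ) (v : HexVertex) :
    ℂ := (M.l n)⁻¹ • (M.coeff qd i n v - M.coeff qd j n v)

/-- Solving `coeff_relation` gives `c_{j+1} - c_j = c_j * defect / a`, where `a` has the nonzero
limit `ω² (ω - ω²) (dir j * g')²`. Since the defect divided by `l` still tends to zero, one power of
`l` is gained. -/
theorem edgeDiff_sc (hg : Differentiable ℂ g) (hg' : ∀ z, deriv g z ≠ 0)
    (hnd : ∀ n, NonDegenerate g (M.z n))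
    (hqd : ∀ n, IsHolomorphicQuadraticDifferential g (M.z n) (qd n)) {k : ℕ}
    (h : ∀ j, M.SC k (M.coeff qd j) q) (i j : Fin 3) :
    M.SC k (M.edgeDiff qd i j) fun _ => 0 := by
  have step : ∀ j, M.SC k (M.edgeDiff qd (j + 1) j) fun _ => 0 := fun j => by
    have sl := fun i => slope_sc (M := M) hg i k
    have a := ((SC.const (M := M) k (omega ^ 2)).mul ((sl (j + 1)).sub (sl (j + 2)))).mul (sl j)
    have ha : ∀ z, omega ^ 2 * (M.dir (j + 1) * deriv g z - M.dir (j + 2) * deriv g z) *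
        (M.dir j * deriv g z) ≠ 0 := fun z => by
      have h0 : omega ≠ 0 := norm_ne_zero_iff.1 (by rw [norm_omega]; exact one_ne_zero)
      have h1 : omega - omega ^ 2 ≠ 0 := by
        intro h
        have := congrArg Complex.im h
        rw [omega_sq, omega_eq] at this
        simp at this
      rw [dir_add_one, dir_add_two]
      have h2 : omega ^ 2 * (omega * M.dir j * deriv g z - omega ^ 2 * M.dir j * deriv g z) *
        (M.dir j * deriv g z) = omega ^ 2 * (omega - omega ^ 2) * (M.dir j * deriv g z) ^ 2 := by
        ring
      rw [h2]
      exact mul_ne_zero (mul_ne_zero (pow_ne_zero 2 h0) h1)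
        (pow_ne_zero 2 (mul_ne_zero (dir_ne j) (hg' z)))
    have b := ((h j).mul ((defect_sc (M := M) hg j k).mul (a.inv ha))).congr_limit
      (ψ := fun _ => 0) fun z => by simp
    refine b.congr fun z₀ => ?_
    filter_upwards [(a.conv z₀).eventually_ne (ha z₀)] with x hx
    have hr := coeff_relation (hnd x.1) (hqd x.1) x.2 j
    have hl := l_ne_complex (M := M) x.1
    simp only [edgeDiff, real_smul, ofReal_inv]
    generalize omega ^ 2 * (M.slope g (j + 1) x.1 x.2 - M.slope g (j + 2) x.1 x.2) *
      M.slope g j x.1 x.2 = a' at hr hx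
    field_simp
    linear_combination hr
  have neg : ∀ i j, M.SC k (M.edgeDiff qd i j) (fun _ => 0) →
      M.SC k (M.edgeDiff qd j i) fun _ => 0 := fun i j h => by
    have := h.neg
    simp only [neg_zero] at this
    convert this using 1
    funext n v
    simp only [edgeDiff, ← smul_neg, neg_sub]
  obtain rfl | rfl | rfl : i = j ∨ i = j + 1 ∨ j = i + 1 := by decide +revert
  · convert SC.const (M := M) k (0 : ℂ) using 1
    funext n v
    simp [edgeDiff]
  · exact step j
  · exact neg _ _ (step i)

/-! ### Propagation of the coefficients along periods, and the bootstrap. -/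

theorem coeff_nbr {n : ℕ} (hq : IsHolomorphicQuadraticDifferential g (M.z n) (qd n))
    (v : HexVertex) (j : Fin 3) : M.coeff qd j n (nbr v j) = M.coeff qd j n v := by
  rw [coeff, coeff, nbr_nbr, hq.symm, ← neg_sub, neg_sq]

/-- The period leading from a black vertex along the edge number `i` and back along an edge
number `0`. -/
def gen (i : Fin 3) : ℤ × ℤ := (- ![0, 1, 0] i, - ![0, 0, 1] i)

theorem nbr_translate_gen_of_black {v : HexVertex} (hv : ¬v.white) (i : Fin 3) :
    nbr (DiscreteWeierstrass.translate v (gen i)) 0 = DiscreteWeierstrass.nbr v i := by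
  rcases v with ⟨m, n, _ | _⟩
  · simp [DiscreteWeierstrass.nbr, DiscreteWeierstrass.translate, gen, sub_eq_add_neg]
  · simp at hv

theorem nbr_translate_gen_of_white {v : HexVertex} (hv : v.white) (i : Fin 3) :
    nbr (DiscreteWeierstrass.translate v (gen i)) i = DiscreteWeierstrass.nbr v 0 := by
  rcases v with ⟨m, n, _ | _⟩
  · simp at hv
  · simp [DiscreteWeierstrass.nbr, DiscreteWeierstrass.translate, gen]

/-- A vertex and its translate by `gen i` have a common neighbour. The change of a coefficient is
the sum of three `edgeDiff`s, at the translate, at this neighbour and at the vertex, glued by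
`coeff_nbr`. -/
theorem coeff_quot_sc (hg : Differentiable ℂ g) (hg' : ∀ z, deriv g z ≠ 0)
    (hnd : ∀ n, NonDegenerate g (M.z n))
    (hqd : ∀ n, IsHolomorphicQuadraticDifferential g (M.z n) (qd n)) {k : ℕ}
    (h : ∀ j, M.SC k (M.coeff qd j) q) (j : Fin 3) (w : ℤ × ℤ) :
    M.SC k (M.quot w (M.coeff qd j)) fun _ => 0 := by
  have e := edgeDiff_sc hg hg' hnd hqd h
  have key : ∀ i, M.SC k (M.quot (gen i) (M.coeff qd j)) fun _ => 0 := fun i => by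
    have b := ((((e j 0).translate (gen i)).add ((e 0 i).nbr i)).add (e i j)).congr_limit
      (ψ := fun _ => 0) fun z => by simp
    have c := ((((e j i).translate (gen i)).add ((e i 0).nbr 0)).add (e 0 j)).congr_limit
      (ψ := fun _ => 0) fun z => by simp
    convert c.ite b using 1
    funext n v
    split_ifs with hv
    · have h1 := coeff_nbr (hqd n) (DiscreteWeierstrass.translate v (gen i)) i
      have h2 := coeff_nbr (hqd n) v 0
      rw [nbr_translate_gen_of_white hv] at h1
      simp only [Mesh.quot, edgeDiff, ← smul_add, ← h1, ← h2]
      congr 1; ring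
    · have h1 := coeff_nbr (hqd n) (DiscreteWeierstrass.translate v (gen i)) 0
      have h2 := coeff_nbr (hqd n) v i
      rw [nbr_translate_gen_of_black hv] at h1
      simp only [Mesh.quot, edgeDiff, ← smul_add, ← h1, ← h2]
      congr 1; ring
  exact sc_quot_zero (key 1) (key 2) w

/-- A quadratic differential discretised by discrete holomorphic quadratic differentials on
hexagonal lattices has a constant coefficient, and the coefficients converge with all difference
quotients. -/
theorem coeff_sc (hg : Differentiable ℂ g) (hg' : ∀ z, deriv g z ≠ 0) (hq : Differentiable ℂ q)
    (hnd : ∀ n, NonDegenerate g (M.z n))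
    (hqd : ∀ n, IsHolomorphicQuadraticDifferential g (M.z n) (qd n))
    (hcommon : Discretise M.z qd q) :
    (∀ z, q z = q 0) ∧ ∀ j k, M.SC k (M.coeff qd j) fun _ => q 0 := by
  have hq' : ContDiff ℝ ∞ q := hq.contDiff.restrict_scalars ℝ
  have h0 : ∀ j, M.SC 0 (M.coeff qd j) q := fun j =>
    ⟨hq', conv_of_uniform hq.continuous fun K hK ε hε => by
      filter_upwards [hcommon K hK ε hε] with n hn v hv using hn v j hv⟩
  have h1 := coeff_quot_sc hg hg' hnd hqd h0
  -- Vanishing difference quotients make the limit constant; the vertices of the cell at the origin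
  -- converge to `0` and give the value `q 0`.
  have h2 : ∀ j, M.Conv (M.coeff qd j) fun _ => q 0 := fun j => by
    have h3 : M.Conv (fun n v => M.coeff qd j n v - q 0) fun _ => 0 := by
      have h4 : ∀ w, M.quot w (fun n v => M.coeff qd j n v - q 0) = M.quot w (M.coeff qd j) :=
        fun w => by funext n v; simp [Mesh.quot]
      refine conv_zero_of_quot (h4 _ ▸ (h1 j _).conv) (h4 _ ▸ (h1 j _).conv)
        fun b => ⟨⟨0, 0, b⟩, rfl, ?_⟩
      · simpa using (((h0 j).conv 0).comp (tendsto_near_fixed ⟨0, 0, b⟩)).sub_const (q 0)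
    intro z₀
    simpa using (h3 z₀).add_const (q 0)
  have h3 : ∀ z, q z = q 0 := fun z => congrFun ((h0 0).conv.unique (h2 0)) z
  refine ⟨h3, fun j k => ?_⟩
  -- Bootstrap: convergence of order `k` of all coefficients gives order `k` of their quotients,
  -- that is, order `k + 1`.
  induction k generalizing j with
  | zero => exact (h0 j).congr_limit h3
  | succ k ih =>
    refine ⟨contDiff_const, h2 j, fun w => ?_⟩
    exact (coeff_quot_sc hg hg' hnd hqd ih j w).congr_limit fun z => by simp

end Mesh

/-! ### The classical Weierstrass surface -/

/-- The real part of a vector in `ℂ³`. -/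
def reE3 : (Fin 3 → ℂ) →L[ℝ] E3 :=
  ((PiLp.continuousLinearEquiv 2 ℝ fun _ : Fin 3 => ℝ).symm : (Fin 3 → ℝ) →L[ℝ] E3).comp
    (ContinuousLinearMap.pi fun k => reCLM.comp (ContinuousLinearMap.proj k))

@[simp]
theorem reE3_apply (w : Fin 3 → ℂ) (k : Fin 3) : reE3 w k = (w k).re := rfl

theorem reE3_eq (w : Fin 3 → ℂ) : reE3 w = WithLp.toLp 2 fun k => (w k).re := rfl

section

variable {g q : ℂ → ℂ}

theorem differentiable_weierstrassForm {Q : ℂ → ℂ} (hg : Differentiable ℂ g)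
    (hg' : ∀ z, deriv g z ≠ 0) (hQ : Differentiable ℂ Q) (k : Fin 3) :
    Differentiable ℂ fun z => weierstrassForm g Q z k := by
  have h := EntireConv.differentiable_deriv hg
  have h1 : Differentiable ℂ fun z => Q z / deriv g z := fun z => (hQ z).div (h z) (hg' z)
  fin_cases k <;> simp [weierstrassForm] <;> fun_prop

/-- An entire form is exact on `ℂ`, so the integral along the segment is the increment of a
primitive. -/
theorem exists_primitive_weierstrassForm {Q : ℂ → ℂ} (hg : Differentiable ℂ g)
    (hg' : ∀ z, deriv g z ≠ 0) (hQ : Differentiable ℂ Q) (x₀ : E3) :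
    ∃ P : Fin 3 → ℂ → ℂ, (∀ k z, HasDerivAt (P k) (weierstrassForm g Q z k) z) ∧
      ∀ z, weierstrassSurface g Q x₀ z = x₀ + reE3 fun k => P k z := by
  have hΦ := differentiable_weierstrassForm hg hg' hQ
  choose P hP using fun k => (hΦ k).isExactOn_univ
  refine ⟨fun k z => P k z - P k 0, fun k z => (hP k z (Set.mem_univ z)).sub_const _, fun z => ?_⟩
  rw [weierstrassSurface, reE3_eq]
  congr 2
  funext k
  have h1 : ∀ t ∈ Set.uIcc (0 : ℝ) 1, HasDerivAt (fun t : ℝ => P k (t * z))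
      (z * weierstrassForm g Q (t * z) k) t := fun t _ => by
    have h2 : HasDerivAt (fun t : ℝ => (t : ℂ) * z) (1 * z) t :=
      (Complex.ofRealCLM.hasDerivAt (x := t)).mul_const z
    have h3 := (hP k (t * z) (Set.mem_univ _)).comp t h2
    refine h3.congr_deriv ?_
    ring
  rw [intervalIntegral.integral_eq_sub_of_hasDerivAt h1]
  · simp
  · have := (hΦ k).continuous
    exact Continuous.intervalIntegrable (by fun_prop) _ _

end

namespace Mesh

variable {M : Mesh} {g q : ℂ → ℂ} {qd : ℕ → HexVertex → Fin 3 → ℂ}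

theorem SC.pi {k : ℕ} {f : ℕ → HexVertex → Fin 3 → ℂ} {φ : ℂ → Fin 3 → ℂ}
    (h : ∀ i, M.SC k (fun n v => f n v i) fun z => φ z i) : M.SC k f φ := by
  have h1 := SC.sum Finset.univ fun i =>
    (h i).clm (ContinuousLinearMap.single ℝ (fun _ : Fin 3 => ℂ) i)
  have e : ∀ y : Fin 3 → ℂ, ∑ i, ContinuousLinearMap.single ℝ (fun _ : Fin 3 => ℂ) i (y i) = y :=
    fun y => by simpa using Finset.univ_sum_single y
  simpa only [e] using h1

theorem weierstrassSurface_sc {Q : ℂ → ℂ} (hg : Differentiable ℂ g)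
    (hg' : ∀ z, deriv g z ≠ 0) (hQ : Differentiable ℂ Q) (x₀ : E3) (k : ℕ) :
    M.SC k (fun n v => weierstrassSurface g Q x₀ (M.z n v)) (weierstrassSurface g Q x₀) := by
  obtain ⟨P, hP, hX⟩ := exists_primitive_weierstrassForm hg hg' hQ x₀
  have h := (SC.const (M := M) k x₀).add ((SC.pi (f := fun n v i => P i (M.z n v))
    (φ := fun z i => P i z) fun i =>
    (EntireConv.const fun z => (hP i z).differentiableAt).sc (M := M) k).clm reE3)
  rw [funext hX]
  simpa only [hX] using h

end Mesh

theorem fderiv_weierstrassSurface {g Q : ℂ → ℂ} (hg : Differentiable ℂ g)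
    (hg' : ∀ z, deriv g z ≠ 0) (hQ : Differentiable ℂ Q) (x₀ : E3) (z c : ℂ) :
    fderiv ℝ (weierstrassSurface g Q x₀) z c = reE3 (c • weierstrassForm g Q z) := by
  obtain ⟨P, hP, hX⟩ := exists_primitive_weierstrassForm hg hg' hQ x₀
  have h1 : HasFDerivAt (fun z k => P k z) (ContinuousLinearMap.pi fun k =>
      weierstrassForm g Q z k • (1 : ℂ →L[ℝ] ℂ)) z :=
    hasFDerivAt_pi.2 fun k => (hP k z).complexToReal_fderiv
  have h2 := (reE3.hasFDerivAt.comp z h1).const_add x₀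
  rw [show weierstrassSurface g Q x₀ = fun z => x₀ + (reE3 ∘ fun z k => P k z) z from funext hX,
    h2.fderiv, ContinuousLinearMap.comp_apply]
  congr 1
  funext k
  simp [mul_comm]

/-! ### Convergence and harmonicity of the discrete surfaces. -/

namespace Mesh

variable {M : Mesh} {g q : ℂ → ℂ} {qd : ℕ → HexVertex → Fin 3 → ℂ}

/-- The discrete Weierstrass form divided by the signed edge length. -/
def form (M : Mesh) (g : ℂ → ℂ) (qd : ℕ → HexVertex → Fin 3 → ℂ) (j : Fin 3) (n : ℕ)
    (v : HexVertex) : Fin 3 → ℂ :=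
  (I * M.dir j ^ 2 * M.coeff qd j n v * (M.slope g j n v)⁻¹) •
    ![1 - g (M.z n v) * g (M.z n (nbr v j)), I * (1 + g (M.z n v) * g (M.z n (nbr v j))),
      g (M.z n v) + g (M.z n (nbr v j))]

theorem dF_eq (n : ℕ) (v : HexVertex) (j : Fin 3) :
    dF g (M.z n) (qd n) v j = ((M.l n * sgn v : ℝ) : ℂ) • M.form g qd j n v := by
  have h := sgn_mul_self_complex v
  have hs : (sgn v : ℂ) ≠ 0 := left_ne_zero_of_mul_eq_one h
  have hl := l_ne_complex (M := M) n
  rw [dF, form, smul_smul, qd_eq (M := M) qd, dAlong_eq]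
  congr 1
  rw [div_eq_mul_inv, mul_inv, mul_inv, inv_eq_of_mul_eq_one_left h]
  push_cast
  field_simp

/-- The prefactor tends to `I c dir j / g'`, and the vector to twice the one in `weierstrassForm`;
hence `Q = 2 i q`. -/
theorem form_sc (hg : Differentiable ℂ g) (hg' : ∀ z, deriv g z ≠ 0) {c : ℂ} {k : ℕ}
    (hQ : ∀ j, M.SC k (M.coeff qd j) fun _ => c) (j : Fin 3) :
    M.SC k (M.form g qd j) fun z => M.dir j • weierstrassForm g (fun _ => 2 * I * c) z := by
  have cst := fun a : ℂ => SC.const (M := M) k a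
  have a := (EntireConv.const hg).sc (M := M) k
  have b := a.nbr j
  have s := (((cst (I * M.dir j ^ 2)).mul (hQ j)).mul ((slope_sc (M := M) hg j k).inv fun z =>
    mul_ne_zero (dir_ne j) (hg' z)))
  have hd := dir_ne (M := M) j
  refine SC.pi fun i => ?_
  fin_cases i
  · refine (s.mul ((cst 1).sub (a.mul b))).congr_limit fun z => ?_
    have := hg' z
    simp [weierstrassForm]; field_simp
  · refine (s.mul ((cst I).mul ((cst 1).add (a.mul b)))).congr_limit fun z => ?_
    have := hg' z
    simp [weierstrassForm]; field_simp
  · refine (s.mul (a.add b)).congr_limit fun z => ?_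
    have := hg' z
    simp [weierstrassForm]; field_simp; ring

theorem realization_sub {X : ℕ → HexVertex → E3} {n : ℕ}
    (hX : IsWeierstrassRealization g (M.z n) (qd n) (X n)) (v : HexVertex) (j : Fin 3) :
    X n (nbr v j) - X n v = (M.l n * sgn v) • reE3 (M.form g qd j n v) := by
  rw [hX v j, dF_eq, ← map_smul, reE3_eq]
  simp

theorem realization_sc (hg : Differentiable ℂ g) (hg' : ∀ z, deriv g z ≠ 0) {c : ℂ}
    (hQ : ∀ j k, M.SC k (M.coeff qd j) fun _ => c) {X : ℕ → HexVertex → E3}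
    (hX : ∀ n, IsWeierstrassRealization g (M.z n) (qd n) (X n)) {v₀ : HexVertex} {x₀ : E3}
    (hx₀ : Tendsto (fun n => X n v₀) atTop (𝓝 x₀)) (k : ℕ) :
    M.SC k X (weierstrassSurface g (fun _ => 2 * I * c) x₀) := by
  set Y := weierstrassSurface g (fun _ => 2 * I * c) x₀ with hY
  have hc : Differentiable ℂ fun _ : ℂ => 2 * I * c := differentiable_const _
  have hYs : ∀ k, M.SC k (fun n v => Y (M.z n v)) Y := weierstrassSurface_sc hg hg' hc x₀
  have hf := fun j k => (form_sc hg hg' (fun j => hQ j k) j).clm reE3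
  -- A vertex and its translate by `gen i` share a neighbour, so the quotient is a difference of two
  -- edge forms; correspondingly `dir i - dir 0 = per (gen i)`.
  have key : ∀ i k, M.SC k (M.quot (gen i) X) fun z => fderiv ℝ Y z (M.per (gen i)) := by
    intro i k
    have h1 : ∀ z, reE3 (M.dir i • weierstrassForm g (fun _ => 2 * I * c) z) -
        reE3 (M.dir 0 • weierstrassForm g (fun _ => 2 * I * c) z)
        = fderiv ℝ Y z (M.per (gen i)) := fun z => by
      rw [hY, fderiv_weierstrassSurface hg hg' hc, ← map_sub, ← sub_smul]
      congr 2
      fin_cases i <;> simp [dir, per, gen, period] <;> ring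
    have b := ((hf i k).sub ((hf 0 k).translate (gen i))).congr_limit h1
    have w := (((hf i k).translate (gen i)).sub (hf 0 k)).congr_limit h1
    convert w.ite b using 1
    funext n v
    have hl := l_ne (M := M) n
    rw [Mesh.quot, inv_smul_eq_iff₀ hl]
    split_ifs with hv
    · have e1 := realization_sub (hX n) (DiscreteWeierstrass.translate v (gen i)) i
      have e2 := realization_sub (hX n) v 0
      rw [nbr_translate_gen_of_white hv] at e1
      have s1 : sgn v = -1 := if_pos hv
      have s2 : sgn (DiscreteWeierstrass.translate v (gen i)) = -1 := if_pos hv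
      rw [s1] at e2
      rw [s2] at e1
      rw [← sub_sub_sub_cancel_left _ _ (X n (nbr v 0)), e1, e2]
      module
    · have e1 := realization_sub (hX n) (DiscreteWeierstrass.translate v (gen i)) 0
      have e2 := realization_sub (hX n) v i
      rw [nbr_translate_gen_of_black hv] at e1
      have s1 : sgn v = 1 := if_neg hv
      have s2 : sgn (DiscreteWeierstrass.translate v (gen i)) = 1 := if_neg hv
      rw [s1] at e2
      rw [s2] at e1
      rw [← sub_sub_sub_cancel_left _ _ (X n (nbr v i)), e1, e2]
      module
  have hd : ∀ w k, M.SC k (M.quot w fun n v => X n v - Y (M.z n v)) fun _ => 0 := by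
    have h1 : ∀ i k, M.SC k (M.quot (gen i) fun n v => X n v - Y (M.z n v)) fun _ => 0 := by
      intro i k
      have h2 := ((key i k).sub ((hYs (k + 1)).quot (gen i))).congr_limit (ψ := fun _ => 0)
        fun z => sub_self _
      convert h2 using 1
      funext n v
      simp only [Mesh.quot, ← smul_sub]
      congr 1; abel
    exact fun w k => sc_quot_zero (h1 1 k) (h1 2 k) w
  have hbase : ∀ u, Tendsto (fun n => X n u) atTop (𝓝 x₀) →
      Tendsto (fun n => X n u - Y (M.z n u)) atTop (𝓝 0) := fun u hu => by
    have h1 := hu.sub (((hYs 0).conv 0).comp (tendsto_near_fixed u))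
    have h2 : Y 0 = x₀ := by
      rw [hY, weierstrassSurface]
      simp only [zero_mul, intervalIntegral.integral_zero, zero_re]
      exact add_zero x₀
    rwa [h2, sub_self] at h1
  -- Periods do not join the two colours, so the constant must also be fixed at a neighbour of `v₀`.
  have hnb : Tendsto (fun n => X n (nbr v₀ 0)) atTop (𝓝 x₀) := by
    have h1 := (M.l_lim.mul_const (sgn v₀)).smul
      (((hf 0 0).conv 0).comp (tendsto_near_fixed v₀))
    rw [zero_mul, zero_smul] at h1
    have h2 := hx₀.add h1
    rw [add_zero] at h2
    refine h2.congr fun n => ?_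
    rw [← sub_add_cancel (X n (nbr v₀ 0)) (X n v₀), realization_sub (hX n) v₀ 0, add_comm]
    rfl
  have h0 : M.Conv (fun n v => X n v - Y (M.z n v)) fun _ => 0 := by
    refine conv_zero_of_quot (hd _ 0).conv (hd _ 0).conv fun b => ?_
    by_cases hb : v₀.white = b
    · exact ⟨v₀, hb, hbase v₀ hx₀⟩
    · refine ⟨nbr v₀ 0, ?_, hbase _ hnb⟩
      rcases v₀ with ⟨m, n, _ | _⟩ <;> cases b <;> simp_all [DiscreteWeierstrass.nbr]
  have h1 : M.SC k (fun n v => X n v - Y (M.z n v)) fun _ => 0 := by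
    cases k with
    | zero => exact ⟨contDiff_const, h0⟩
    | succ k => exact ⟨contDiff_const, h0, fun w => (hd w k).congr_limit fun z => by simp⟩
  simpa using h1.add (hYs k)

/-- Substituting `g_b = g_a + dg` splits `dF` into a multiple of `q / dg` and a multiple of `q`,
with factors depending only on `g_a`; both sums vanish. -/
theorem isDiscreteHarmonic {X : ℕ → HexVertex → E3} {n : ℕ} (hnd : NonDegenerate g (M.z n))
    (hq : IsHolomorphicQuadraticDifferential g (M.z n) (qd n))
    (hX : IsWeierstrassRealization g (M.z n) (qd n) (X n)) : IsDiscreteHarmonic (X n) := by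
  intro v
  have h1 := hq.sum_q v
  have h2 := sum_div_dAlong hq v
  have h3 : ∀ k, ∑ j, dF g (M.z n) (qd n) v j k = 0 := by
    have hd : ∀ j, dAlong g (M.z n) v j ≠ 0 := fun j => sub_ne_zero.2 (hnd v j)
    have hb : ∀ j, g (M.z n (nbr v j)) = g (M.z n v) + dAlong g (M.z n) v j := fun j => by
      rw [dAlong]; ring
    set a := g (M.z n v) with ha
    have e : ∀ k j, dF g (M.z n) (qd n) v j k =
        I * ![1 - a ^ 2, I * (1 + a ^ 2), 2 * a] k * (qd n v j / dAlong g (M.z n) v j) +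
          I * ![-a, I * a, 1] k * qd n v j := fun k j => by
      have := hd j
      fin_cases k <;> simp [dF, hb, ← ha] <;> field_simp <;> ring
    intro k
    rw [Finset.sum_congr rfl fun j _ => e k j, Finset.sum_add_distrib, ← Finset.mul_sum,
      ← Finset.mul_sum, h1, h2, mul_zero, mul_zero, add_zero]
  rw [Finset.sum_congr rfl fun j _ => hX v j]
  ext k
  simp only [WithLp.ofLp_sum, Finset.sum_apply, ← Complex.re_sum, h3 k]
  simp

end Mesh

/-! ### The Gauss map and the fundamental forms -/

/-- The isotropic vector with Gauss map `w`. -/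
def isoVec (w : ℂ) : Fin 3 → ℂ := ![(1 - w ^ 2) / 2, I * (1 + w ^ 2) / 2, w]

/-- The difference of the values of `pseudoNormal` at `b` and `a`, as a linear function of
`δ = b - a`. -/
def normalDiff (a b δ : ℂ) : E3 :=
  (1 + ‖b‖ ^ 2)⁻¹ • (!₂[2 * δ.re, 2 * δ.im, 0] + inner ℝ δ (a + b) • (!₂[0, 0, 1] - pseudoNormal a))

theorem norm_sq_eq (w : ℂ) : ‖w‖ ^ 2 = w.re ^ 2 + w.im ^ 2 := by
  rw [← normSq_eq_norm_sq, normSq_apply]; ring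

/-- An exact divided difference: dividing by `l` then needs no Taylor expansion of the normal. -/
theorem pseudoNormal_sub (a b : ℂ) :
    pseudoNormal b - pseudoNormal a = normalDiff a b (b - a) := by
  have h1 : 1 + (a.re ^ 2 + a.im ^ 2) ≠ 0 := by positivity
  have h2 : 1 + (b.re ^ 2 + b.im ^ 2) ≠ 0 := by positivity
  ext i
  fin_cases i <;>
    simp [normalDiff, pseudoNormal, norm_sq_eq, Complex.inner] <;> field_simp <;> ring

theorem normalDiff_smul (a b δ : ℂ) (t : ℝ) :
    normalDiff a b (t * δ) = t • normalDiff a b δ := by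
  ext i
  fin_cases i <;> simp [normalDiff, Complex.inner] <;> ring

theorem norm_pseudoNormal (w : ℂ) : ‖pseudoNormal w‖ = 1 := by
  have h1 : 1 + (w.re ^ 2 + w.im ^ 2) ≠ 0 := by positivity
  rw [← sq_eq_sq₀ (norm_nonneg _) zero_le_one, EuclideanSpace.real_norm_sq_eq, Fin.sum_univ_three]
  simp [pseudoNormal, norm_sq_eq]
  field_simp
  ring

/-- The vector is isotropic for the complex bilinear product, so only the Hermitian part, with
squared norm `(1 + ‖w‖²)² / 2`, contributes. This is conformality. -/
theorem inner_isoVec (w α β : ℂ) :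
    inner ℝ (reE3 (α • isoVec w)) (reE3 (β • isoVec w)) =
      (1 + ‖w‖ ^ 2) ^ 2 / 4 * (α * (starRingEnd ℂ) β).re := by
  rw [PiLp.inner_apply, Fin.sum_univ_three, norm_sq_eq]
  simp [isoVec, pow_two]
  ring

theorem inner_isoVec_normalDiff (w α δ : ℂ) :
    inner ℝ (reE3 (α • isoVec w)) (normalDiff w w δ) = (α * δ).re := by
  have h1 : 1 + (w.re ^ 2 + w.im ^ 2) ≠ 0 := by positivity
  rw [PiLp.inner_apply, Fin.sum_univ_three]
  simp [isoVec, normalDiff, pseudoNormal, norm_sq_eq, Complex.inner, pow_two w]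
  field_simp
  ring

theorem cross_isoVec (w c : ℂ) :
    (WithLp.toLp 2 ((reE3 (c • isoVec w)).ofLp ⨯₃ (reE3 ((I * c) • isoVec w)).ofLp) : E3) =
      ((1 + ‖w‖ ^ 2) ^ 2 / 4 * ‖c‖ ^ 2) • pseudoNormal w := by
  have h1 : 1 + (w.re ^ 2 + w.im ^ 2) ≠ 0 := by positivity
  ext i
  rw [cross_apply]
  fin_cases i <;>
    simp [isoVec, pseudoNormal, norm_sq_eq, pow_two w] <;> field_simp <;> ring

theorem weierstrassForm_eq (g Q : ℂ → ℂ) (z : ℂ) :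
    weierstrassForm g Q z = (Q z / deriv g z) • isoVec (g z) := rfl

theorem meanOf_eq (A B : Matrix (Fin 2) (Fin 2) ℝ) :
    meanOf A B = (A 1 1 * B 0 0 - A 0 1 * B 1 0 - A 1 0 * B 0 1 + A 0 0 * B 1 1) *
      (A 0 0 * A 1 1 - A 0 1 * A 1 0)⁻¹ / 2 := by
  rw [meanOf, Matrix.inv_def, Matrix.adjugate_fin_two, Matrix.trace_fin_two, Ring.inverse_eq_inv',
    Matrix.det_fin_two]
  simp [Matrix.mul_apply, Fin.sum_univ_two]
  ring

theorem gaussOf_eq (A B : Matrix (Fin 2) (Fin 2) ℝ) :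
    gaussOf A B = (B 0 0 * B 1 1 - B 0 1 * B 1 0) * (A 0 0 * A 1 1 - A 0 1 * A 1 0)⁻¹ := by
  rw [gaussOf, Matrix.det_mul, Matrix.det_nonsing_inv, Ring.inverse_eq_inv', Matrix.det_fin_two,
    Matrix.det_fin_two, mul_comm]

/-! ### The normal and the first fundamental form of the classical surface. -/

section Smooth

variable {g Q : ℂ → ℂ}

theorem pseudoNormal_comp_sc {M : Mesh} (hg : Differentiable ℂ g) (k : ℕ) :
    M.SC k (fun n v => pseudoNormal (g (M.z n v))) fun z => pseudoNormal (g z) := by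
  have a := (EntireConv.const hg).sc (M := M) k
  have one := Mesh.SC.const (M := M) k (1 : ℝ)
  have aa := a.inner a
  have c := fun x : E3 => Mesh.SC.const (M := M) k x
  have h := ((one.add aa).inv fun z => by
      have : 0 ≤ inner ℝ (g z) (g z) := real_inner_self_nonneg
      positivity).smul
    ((((a.clm reCLM).smul (c !₂[2, 0, 0])).add ((a.clm imCLM).smul (c !₂[0, 2, 0]))).add
      ((aa.sub one).smul (c !₂[0, 0, 1])))
  have e : ∀ w : ℂ, pseudoNormal w = (1 + inner ℝ w w)⁻¹ • (reCLM w • (!₂[2, 0, 0] : E3) +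
      imCLM w • (!₂[0, 2, 0] : E3) + (inner ℝ w w - 1) • (!₂[0, 0, 1] : E3)) := fun w => by
    rw [real_inner_self_eq_norm_sq]
    ext i
    fin_cases i <;> simp [pseudoNormal, mul_comm]
  simpa only [e] using h

theorem normalDiff_sc {M : Mesh} (hg : Differentiable ℂ g) {δ : ℕ → HexVertex → ℂ} {ψ : ℂ → ℂ}
    {k : ℕ} (hδ : M.SC k δ ψ) (j : Fin 3) :
    M.SC k (fun n v => normalDiff (g (M.z n v)) (g (M.z n (nbr v j))) (δ n v))
      fun z => normalDiff (g z) (g z) (ψ z) := by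
  have a := (EntireConv.const hg).sc (M := M) k
  have b := a.nbr j
  have one := Mesh.SC.const (M := M) k (1 : ℝ)
  have c := fun x : E3 => Mesh.SC.const (M := M) k x
  have h := ((one.add (b.inner b)).inv fun z => by
      have : 0 ≤ inner ℝ (g z) (g z) := real_inner_self_nonneg
      positivity).smul
    ((((hδ.clm reCLM).smul (c !₂[2, 0, 0])).add ((hδ.clm imCLM).smul (c !₂[0, 2, 0]))).add
      ((hδ.inner (a.add b)).smul ((c !₂[0, 0, 1]).sub (pseudoNormal_comp_sc hg k))))
  have e : ∀ a b δ : ℂ, normalDiff a b δ = (1 + inner ℝ b b)⁻¹ • (reCLM δ • (!₂[2, 0, 0] : E3) +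
      imCLM δ • (!₂[0, 2, 0] : E3) +
      inner ℝ δ (a + b) • ((!₂[0, 0, 1] : E3) - pseudoNormal a)) := fun a b δ => by
    rw [real_inner_self_eq_norm_sq, normalDiff]
    congr 2
    ext i
    fin_cases i <;> simp <;> ring
  simpa only [e] using h

theorem fderiv_pseudoNormal_comp (hg : Differentiable ℂ g)
    (hN : Differentiable ℝ fun z => pseudoNormal (g z)) (z c : ℂ) :
    fderiv ℝ (fun z => pseudoNormal (g z)) z c = normalDiff (g z) (g z) (deriv g z * c) := by
  -- Differentiability being known, the derivative can be computed along real lines, as the limit of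
  -- the exact divided differences.
  rw [← (hN z).lineDeriv_eq_fderiv]
  refine HasLineDerivAt.lineDeriv (hasDerivAt_iff_tendsto_slope.2 ?_)
  have h1 : HasDerivAt (fun t : ℝ => g (z + t • c)) (deriv g z * c) 0 := by
    have h2 : HasDerivAt (fun t : ℝ => z + (t : ℂ) * c) (1 * c) 0 :=
      ((Complex.ofRealCLM.hasDerivAt (x := 0)).mul_const c).const_add z
    have h3 : HasDerivAt g (deriv g z) (z + ((0 : ℝ) : ℂ) * c) := by
      simpa using (hg z).hasDerivAt
    have h4 := h3.comp (0 : ℝ) h2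
    rw [one_mul] at h4
    exact h4
  have h2 := hasDerivAt_iff_tendsto_slope.1 h1
  have h3 := (h1.continuousAt.tendsto).mono_left (nhdsWithin_le_nhds (s := {0}ᶜ))
  have h4 : Continuous fun x : ℂ × ℂ => normalDiff (g z) x.1 x.2 := by
    have e : ∀ b δ : ℂ, normalDiff (g z) b δ = (1 + ‖b‖ ^ 2)⁻¹ • (δ.re • (!₂[2, 0, 0] : E3) +
        δ.im • (!₂[0, 2, 0] : E3) +
        inner ℝ δ (g z + b) • ((!₂[0, 0, 1] : E3) - pseudoNormal (g z))) := fun b δ => by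
      rw [normalDiff]
      congr 2
      ext i
      fin_cases i <;> simp <;> ring
    simp only [e]
    have : ∀ x : ℂ × ℂ, 1 + ‖x.1‖ ^ 2 ≠ 0 := fun x => by positivity
    fun_prop (disch := assumption)
  have h5 := (h4.tendsto (_, _)).comp (h3.prodMk_nhds h2)
  simp only [zero_smul, add_zero] at h5
  refine h5.congr fun t => ?_
  simp only [Function.comp_apply, slope, vsub_eq_sub, zero_smul, add_zero, sub_zero,
    pseudoNormal_sub, real_smul]
  rw [← normalDiff_smul]

/-- The conformal factor of the Weierstrass surface. -/
def conformalFactor (g Q : ℂ → ℂ) (z : ℂ) : ℝ := (1 + ‖g z‖ ^ 2) ^ 2 / 4 * ‖Q z / deriv g z‖ ^ 2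

theorem conformalFactor_pos {g Q : ℂ → ℂ} {z : ℂ} (h : Q z ≠ 0) (h' : deriv g z ≠ 0) :
    0 < conformalFactor g Q z := by
  have : 0 < ‖Q z / deriv g z‖ := norm_pos_iff.2 (div_ne_zero h h')
  unfold conformalFactor
  positivity

theorem inner_weierstrassForm (g Q : ℂ → ℂ) (z α β : ℂ) :
    inner ℝ (reE3 (α • weierstrassForm g Q z)) (reE3 (β • weierstrassForm g Q z)) =
      conformalFactor g Q z * (α * (starRingEnd ℂ) β).re := by
  rw [weierstrassForm_eq, smul_smul, smul_smul, inner_isoVec, conformalFactor]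
  generalize Q z / deriv g z = c
  rw [norm_sq_eq c]
  simp only [mul_re, mul_im, map_mul, conj_re, conj_im]
  ring

theorem inner_weierstrassForm_normalDiff {z : ℂ} (h' : deriv g z ≠ 0) (α β : ℂ) :
    inner ℝ (reE3 (α • weierstrassForm g Q z)) (normalDiff (g z) (g z) (deriv g z * β)) =
      (Q z * (α * β)).re := by
  rw [weierstrassForm_eq, smul_smul, inner_isoVec_normalDiff]
  congr 1
  field_simp

theorem partials_weierstrassSurface (hg : Differentiable ℂ g) (hg' : ∀ z, deriv g z ≠ 0)
    (hQ : Differentiable ℂ Q) (x₀ : E3) (z : ℂ) :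
    partials (weierstrassSurface g Q x₀) z =
      ![reE3 ((1 : ℂ) • weierstrassForm g Q z), reE3 (I • weierstrassForm g Q z)] := by
  rw [partials, fderiv_weierstrassSurface hg hg' hQ, fderiv_weierstrassSurface hg hg' hQ]

theorem unitNormal_weierstrassSurface (hg : Differentiable ℂ g) (hg' : ∀ z, deriv g z ≠ 0)
    (hQ : Differentiable ℂ Q) (x₀ : E3) {z : ℂ} (hz : Q z ≠ 0) :
    unitNormal (weierstrassSurface g Q x₀) z = pseudoNormal (g z) := by
  have hp := conformalFactor_pos hz (hg' z)
  rw [unitNormal, partials_weierstrassSurface hg hg' hQ]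
  simp only [Matrix.cons_val_zero, Matrix.cons_val_one, weierstrassForm_eq, smul_smul, one_mul]
  rw [cross_isoVec, norm_smul, norm_pseudoNormal, mul_one, smul_smul]
  change (‖conformalFactor g Q z‖⁻¹ * conformalFactor g Q z) • _ = _
  rw [Real.norm_of_nonneg hp.le, inv_mul_cancel₀ hp.ne', one_smul]

theorem firstForm_weierstrassSurface (hg : Differentiable ℂ g) (hg' : ∀ z, deriv g z ≠ 0)
    (hQ : Differentiable ℂ Q) (x₀ : E3) (z : ℂ) (i j : Fin 2) :
    firstForm (weierstrassSurface g Q x₀) z i j =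
      conformalFactor g Q z * (![1, I] i * (starRingEnd ℂ) (![1, I] j)).re := by
  rw [firstForm, partials_weierstrassSurface hg hg' hQ, innerMatrix, Matrix.of_apply,
    ← inner_weierstrassForm]
  fin_cases i <;> fin_cases j <;> rfl

theorem linearIndependent_partials (hg : Differentiable ℂ g) (hg' : ∀ z, deriv g z ≠ 0)
    (hQ : Differentiable ℂ Q) (x₀ : E3) {z : ℂ} (hz : Q z ≠ 0) :
    LinearIndependent ℝ (partials (weierstrassSurface g Q x₀) z) := by
  have hp := conformalFactor_pos hz (hg' z)
  have h := firstForm_weierstrassSurface hg hg' hQ x₀ z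
  simp only [firstForm, innerMatrix, Matrix.of_apply] at h
  refine linearIndependent_of_ne_zero_of_inner_eq_zero (𝕜 := ℝ) (fun i h0 => ?_) fun i j hij => ?_
  · have h1 := h i i
    rw [h0, inner_zero_left] at h1
    fin_cases i <;> simp at h1 <;> exact hp.ne h1
  · refine (h i j).trans ?_
    fin_cases i <;> fin_cases j <;> simp at hij ⊢

end Smooth

/-! ### Curvatures of the classical surface for constant `Q`, the only case left by rigidity. -/

section Constant

variable {g : ℂ → ℂ}

theorem secondForm_weierstrassSurface (hg : Differentiable ℂ g) (hg' : ∀ z, deriv g z ≠ 0)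
    {s : ℂ} (hs : s ≠ 0) (x₀ : E3) (hN : Differentiable ℝ fun z => pseudoNormal (g z)) (z : ℂ) (i j : Fin 2) :
    secondForm (weierstrassSurface g (fun _ => s) x₀) z i j =
      (s * (![1, I] i * ![1, I] j)).re := by
  have hc : Differentiable ℂ fun _ : ℂ => s := differentiable_const _
  have h1 : unitNormal (weierstrassSurface g (fun _ => s) x₀) = fun z => pseudoNormal (g z) :=
    funext fun z => unitNormal_weierstrassSurface hg hg' hc x₀ hs
  rw [secondForm, h1, partials_weierstrassSurface hg hg' hc, partials, innerMatrix,
    Matrix.of_apply, fderiv_pseudoNormal_comp hg hN, fderiv_pseudoNormal_comp hg hN,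
    ← inner_weierstrassForm_normalDiff (g := g) (Q := fun _ => s) (hg' z)]
  fin_cases i <;> fin_cases j <;> rfl

theorem smoothMean_weierstrassSurface (hg : Differentiable ℂ g) (hg' : ∀ z, deriv g z ≠ 0)
    {s : ℂ} (hs : s ≠ 0) (x₀ : E3) (hN : Differentiable ℝ fun z => pseudoNormal (g z)) (z : ℂ) :
    smoothMean (weierstrassSurface g (fun _ => s) x₀) z = 0 := by
  have hc : Differentiable ℂ fun _ : ℂ => s := differentiable_const _
  rw [smoothMean, meanOf_eq]
  simp only [firstForm_weierstrassSurface hg hg' hc, secondForm_weierstrassSurface hg hg' hs x₀ hN]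
  simp

/-- The second form is `Re (s dz²)`, of determinant `-(Re s)² - (Im s)²`, while the first is the
conformal factor times the identity. -/
theorem smoothGauss_weierstrassSurface (hg : Differentiable ℂ g) (hg' : ∀ z, deriv g z ≠ 0)
    {s : ℂ} (hs : s ≠ 0) (x₀ : E3) (hN : Differentiable ℝ fun z => pseudoNormal (g z)) (z : ℂ) :
    smoothGauss (weierstrassSurface g (fun _ => s) x₀) z =
      -‖s‖ ^ 2 / conformalFactor g (fun _ => s) z ^ 2 := by
  have hc : Differentiable ℂ fun _ : ℂ => s := differentiable_const _
  rw [smoothGauss, gaussOf_eq, norm_sq_eq]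
  simp only [firstForm_weierstrassSurface hg hg' hc, secondForm_weierstrassSurface hg hg' hs x₀ hN]
  simp
  field_simp
  ring

end Constant

/-! ### Convergence of the discrete curvatures -/

namespace Mesh

variable {M : Mesh} {g : ℂ → ℂ} {qd : ℕ → HexVertex → Fin 3 → ℂ}

/-- The increment of the realization along an edge, divided by the signed edge length. -/
def edgeX (M : Mesh) (g : ℂ → ℂ) (qd : ℕ → HexVertex → Fin 3 → ℂ) (j : Fin 3) (n : ℕ)
    (v : HexVertex) : E3 := reE3 (M.form g qd j n v)

/-- The increment of the pseudo-normal along an edge, divided by the signed edge length. -/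
def edgeN (M : Mesh) (g : ℂ → ℂ) (j : Fin 3) (n : ℕ) (v : HexVertex) : E3 :=
  normalDiff (g (M.z n v)) (g (M.z n (nbr v j))) (M.slope g j n v)

theorem pseudoNormal_nbr_sub (n : ℕ) (v : HexVertex) (j : Fin 3) :
    pseudoNormal (g (M.z n (nbr v j))) - pseudoNormal (g (M.z n v)) =
      (M.l n * sgn v) • M.edgeN g j n v := by
  have h := dAlong_eq (M := M) g n v j
  rw [dAlong, ← mul_assoc] at h
  rw [pseudoNormal_sub, h, edgeN, ← normalDiff_smul]
  push_cast
  rfl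

/-- The rescaled first fundamental form. -/
def scaledFirst (M : Mesh) (g : ℂ → ℂ) (qd : ℕ → HexVertex → Fin 3 → ℂ) (a b : Fin 3) (n : ℕ)
    (v : HexVertex) : ℝ := inner ℝ (M.edgeX g qd a n v) (M.edgeX g qd b n v)

/-- The rescaled second fundamental form. -/
def scaledSecond (M : Mesh) (g : ℂ → ℂ) (qd : ℕ → HexVertex → Fin 3 → ℂ) (a b : Fin 3) (n : ℕ)
    (v : HexVertex) : ℝ := inner ℝ (M.edgeX g qd a n v) (M.edgeN g b n v)

/-- The rescaled Gram determinant of a triangle. -/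
def scaledDet (M : Mesh) (g : ℂ → ℂ) (qd : ℕ → HexVertex → Fin 3 → ℂ) (a : Fin 3) (n : ℕ)
    (v : HexVertex) : ℝ :=
  M.scaledFirst g qd a a n v * M.scaledFirst g qd (a + 1) (a + 1) n v -
    M.scaledFirst g qd a (a + 1) n v * M.scaledFirst g qd (a + 1) a n v

section

variable {X : ℕ → HexVertex → E3} {n : ℕ}

/-- Every increment carries the same colour sign, which squares to one; no trace of the colour
remains. -/
theorem triFirst_eq (hX : IsWeierstrassRealization g (M.z n) (qd n) (X n)) (v : HexVertex)
    (a b : Fin 3) (i j : Fin 2) :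
    triFirst (X n) v a b i j = M.l n ^ 2 * M.scaledFirst g qd (![a, b] i) (![a, b] j) n v := by
  have h := sgn_mul_self v
  have e : ∀ i, increments (X n) v a b i = (M.l n * sgn v) • M.edgeX g qd (![a, b] i) n v := by
    intro i
    fin_cases i <;> exact realization_sub hX v _
  rw [triFirst, innerMatrix, Matrix.of_apply, e, e, real_inner_smul_left, real_inner_smul_right,
    scaledFirst]
  linear_combination
    (M.l n ^ 2 * inner ℝ (M.edgeX g qd (![a, b] i) n v) (M.edgeX g qd (![a, b] j) n v)) * h

theorem triSecond_eq (hX : IsWeierstrassRealization g (M.z n) (qd n) (X n)) (v : HexVertex)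
    (a b : Fin 3) (i j : Fin 2) :
    triSecond (X n) (fun v => pseudoNormal (g (M.z n v))) v a b i j =
      M.l n ^ 2 * M.scaledSecond g qd (![a, b] i) (![a, b] j) n v := by
  have h := sgn_mul_self v
  have e : ∀ i, increments (X n) v a b i = (M.l n * sgn v) • M.edgeX g qd (![a, b] i) n v := by
    intro i
    fin_cases i <;> exact realization_sub hX v _
  have e' : ∀ i, increments (fun v => pseudoNormal (g (M.z n v))) v a b i =
      (M.l n * sgn v) • M.edgeN g (![a, b] i) n v := by
    intro i
    fin_cases i <;> exact pseudoNormal_nbr_sub n v _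
  rw [triSecond, innerMatrix, Matrix.of_apply, e, e', real_inner_smul_left, real_inner_smul_right,
    scaledSecond]
  linear_combination
    (M.l n ^ 2 * inner ℝ (M.edgeX g qd (![a, b] i) n v) (M.edgeN g (![a, b] j) n v)) * h

theorem det_triFirst (hX : IsWeierstrassRealization g (M.z n) (qd n) (X n)) (v : HexVertex)
    (a : Fin 3) : (triFirst (X n) v a (a + 1)).det = (M.l n ^ 2) ^ 2 * M.scaledDet g qd a n v := by
  rw [Matrix.det_fin_two]
  simp only [triFirst_eq hX, scaledDet, Matrix.cons_val_zero, Matrix.cons_val_one]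
  ring

theorem meanOf_tri (hX : IsWeierstrassRealization g (M.z n) (qd n) (X n)) (v : HexVertex)
    (a : Fin 3) :
    meanOf (triFirst (X n) v a (a + 1))
      (triSecond (X n) (fun v => pseudoNormal (g (M.z n v))) v a (a + 1)) =
    (M.scaledFirst g qd (a + 1) (a + 1) n v * M.scaledSecond g qd a a n v -
      M.scaledFirst g qd a (a + 1) n v * M.scaledSecond g qd (a + 1) a n v -
      M.scaledFirst g qd (a + 1) a n v * M.scaledSecond g qd a (a + 1) n v +
      M.scaledFirst g qd a a n v * M.scaledSecond g qd (a + 1) (a + 1) n v) *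
      (M.scaledDet g qd a n v)⁻¹ * 2⁻¹ := by
  have hl := l_ne (M := M) n
  rw [meanOf_eq, ← Matrix.det_fin_two, det_triFirst hX, mul_inv]
  simp only [triFirst_eq hX, triSecond_eq hX, Matrix.cons_val_zero, Matrix.cons_val_one]
  generalize (M.scaledDet g qd a n v)⁻¹ = d
  field_simp

theorem gaussOf_tri (hX : IsWeierstrassRealization g (M.z n) (qd n) (X n)) (v : HexVertex)
    (a : Fin 3) :
    gaussOf (triFirst (X n) v a (a + 1))
      (triSecond (X n) (fun v => pseudoNormal (g (M.z n v))) v a (a + 1)) =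
    (M.scaledSecond g qd a a n v * M.scaledSecond g qd (a + 1) (a + 1) n v -
      M.scaledSecond g qd a (a + 1) n v * M.scaledSecond g qd (a + 1) a n v) *
      (M.scaledDet g qd a n v)⁻¹ := by
  have hl := l_ne (M := M) n
  rw [gaussOf_eq, ← Matrix.det_fin_two (triFirst _ _ _ _), det_triFirst hX, mul_inv]
  simp only [triSecond_eq hX, Matrix.cons_val_zero, Matrix.cons_val_one]
  generalize (M.scaledDet g qd a n v)⁻¹ = d
  field_simp

theorem areaAverage_eq (hX : IsWeierstrassRealization g (M.z n) (qd n) (X n)) (v : HexVertex)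
    (f : Fin 3 → ℝ) :
    areaAverage (X n) v f = (∑ a, √(M.scaledDet g qd a n v) * f a) *
      (∑ a, √(M.scaledDet g qd a n v))⁻¹ := by
  have hl := l_ne (M := M) n
  have h : ∀ a, √(triFirst (X n) v a (a + 1)).det = M.l n ^ 2 * √(M.scaledDet g qd a n v) :=
    fun a => by rw [det_triFirst hX, Real.sqrt_mul (by positivity), Real.sqrt_sq (by positivity)]
  simp only [areaAverage, h, mul_assoc, ← Finset.mul_sum]
  rw [mul_div_mul_left _ _ (pow_ne_zero 2 hl), div_eq_mul_inv]

end

theorem dir_mul_conj (j : Fin 3) : M.dir j * (starRingEnd ℂ) (M.dir j) = 1 := by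
  rw [mul_conj, normSq_eq_norm_sq, dir, norm_mul, M.norm_ζ, norm_pow, norm_omega]
  simp

theorem omega_re : omega.re = -1 / 2 := by rw [omega_eq]

/-! ### Limits of the rescaled forms and of the curvatures. -/

section Limits

variable {c : ℂ} {k : ℕ}

theorem edgeX_sc (hg : Differentiable ℂ g) (hg' : ∀ z, deriv g z ≠ 0)
    (hQ : ∀ j, M.SC k (M.coeff qd j) fun _ => c) (j : Fin 3) :
    M.SC k (M.edgeX g qd j)
      fun z => reE3 (M.dir j • weierstrassForm g (fun _ => 2 * I * c) z) :=
  (form_sc hg hg' hQ j).clm reE3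

theorem edgeN_sc (hg : Differentiable ℂ g) (j : Fin 3) :
    M.SC k (M.edgeN g j) fun z => normalDiff (g z) (g z) (deriv g z * M.dir j) :=
  (normalDiff_sc hg (slope_sc (M := M) hg j k) j).congr_limit fun z => by rw [mul_comm]

theorem scaledFirst_sc (hg : Differentiable ℂ g) (hg' : ∀ z, deriv g z ≠ 0)
    (hQ : ∀ j, M.SC k (M.coeff qd j) fun _ => c) (a b : Fin 3) :
    M.SC k (M.scaledFirst g qd a b) fun z => conformalFactor g (fun _ => 2 * I * c) z *
      (M.dir a * (starRingEnd ℂ) (M.dir b)).re :=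
  ((edgeX_sc hg hg' hQ a).inner (edgeX_sc hg hg' hQ b)).congr_limit fun _ =>
    inner_weierstrassForm _ _ _ _ _

theorem scaledSecond_sc (hg : Differentiable ℂ g) (hg' : ∀ z, deriv g z ≠ 0)
    (hQ : ∀ j, M.SC k (M.coeff qd j) fun _ => c) (a b : Fin 3) :
    M.SC k (M.scaledSecond g qd a b) fun _ => (2 * I * c * (M.dir a * M.dir b)).re :=
  ((edgeX_sc hg hg' hQ a).inner (edgeN_sc hg b)).congr_limit fun z =>
    inner_weierstrassForm_normalDiff (Q := fun _ => 2 * I * c) (hg' z) _ _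

theorem re_dir_diag (a : Fin 3) : (M.dir a * (starRingEnd ℂ) (M.dir a)).re = 1 := by
  rw [dir_mul_conj, one_re]

theorem re_dir_right (a : Fin 3) :
    (M.dir a * (starRingEnd ℂ) (M.dir (a + 1))).re = -1 / 2 := by
  rw [dir_add_one, map_mul, mul_left_comm, dir_mul_conj, mul_one, conj_re, omega_re]

theorem re_dir_left (a : Fin 3) :
    (M.dir (a + 1) * (starRingEnd ℂ) (M.dir a)).re = -1 / 2 := by
  rw [dir_add_one, mul_assoc, dir_mul_conj, mul_one, omega_re]

theorem scaledDet_sc (hg : Differentiable ℂ g) (hg' : ∀ z, deriv g z ≠ 0)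
    (hQ : ∀ j, M.SC k (M.coeff qd j) fun _ => c) (a : Fin 3) :
    M.SC k (M.scaledDet g qd a)
      fun z => 3 / 4 * conformalFactor g (fun _ => 2 * I * c) z ^ 2 := by
  have e := scaledFirst_sc hg hg' hQ
  refine (((e a a).mul (e (a + 1) (a + 1))).sub ((e a (a + 1)).mul (e (a + 1) a))).congr_limit
    fun z => ?_
  rw [re_dir_diag, re_dir_diag, re_dir_right, re_dir_left]
  ring

/-- An average of three functions with a common limit has that limit; `c ≠ 0` keeps the rescaled
areas away from zero. -/
theorem areaAverage_sc (hg : Differentiable ℂ g) (hg' : ∀ z, deriv g z ≠ 0) (hc : c ≠ 0)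
    (hQ : ∀ j, M.SC k (M.coeff qd j) fun _ => c) {X : ℕ → HexVertex → E3}
    (hX : ∀ n, IsWeierstrassRealization g (M.z n) (qd n) (X n))
    {f : Fin 3 → ℕ → HexVertex → ℝ} {φ : ℂ → ℝ} (hf : ∀ a, M.SC k (f a) φ) :
    M.SC k (fun n v => areaAverage (X n) v fun a => f a n v) φ := by
  have hp : ∀ z, 0 < conformalFactor g (fun _ => 2 * I * c) z := fun z =>
    conformalFactor_pos (by simpa using hc) (hg' z)
  have h1 : ∀ z, 0 < 3 / 4 * conformalFactor g (fun _ => 2 * I * c) z ^ 2 := fun z => by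
    have := hp z
    positivity
  have d := fun a => (scaledDet_sc hg hg' hQ a).sqrt h1
  have h := (SC.sum Finset.univ fun a => (d a).mul (hf a)).mul
    ((SC.sum Finset.univ d).inv fun z => by
      have := Real.sqrt_pos.2 (h1 z)
      simpa using this.ne')
  simp only [areaAverage_eq (hX _)]
  refine h.congr_limit fun z => ?_
  have := (Real.sqrt_pos.2 (h1 z)).ne'
  generalize √(3 / 4 * conformalFactor g (fun _ => 2 * I * c) z ^ 2) = d at this
  simp only [Finset.sum_const, Finset.card_univ, Fintype.card_fin, nsmul_eq_mul]
  field_simp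

theorem discreteMean_sc (hg : Differentiable ℂ g) (hg' : ∀ z, deriv g z ≠ 0) (hc : c ≠ 0)
    (hQ : ∀ j, M.SC k (M.coeff qd j) fun _ => c) {X : ℕ → HexVertex → E3}
    (hX : ∀ n, IsWeierstrassRealization g (M.z n) (qd n) (X n)) :
    M.SC k (fun n => discreteMean (X n) fun v => pseudoNormal (g (M.z n v))) fun _ => 0 := by
  refine areaAverage_sc hg hg' hc hQ hX fun a => ?_
  have hp : ∀ z, 0 < conformalFactor g (fun _ => 2 * I * c) z := fun z =>
    conformalFactor_pos (by simpa using hc) (hg' z)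
  have e := scaledFirst_sc hg hg' hQ
  have s := scaledSecond_sc hg hg' hQ
  have h := ((((((e (a + 1) (a + 1)).mul (s a a)).sub ((e a (a + 1)).mul (s (a + 1) a))).sub
    ((e (a + 1) a).mul (s a (a + 1)))).add ((e a a).mul (s (a + 1) (a + 1)))).mul
    ((scaledDet_sc hg hg' hQ a).inv fun z => by
      have := hp z
      positivity)).mul (SC.const k 2⁻¹)
  simp only [meanOf_tri (hX _)]
  refine h.congr_limit fun z => ?_
  rw [re_dir_diag, re_dir_diag, re_dir_right, re_dir_left]
  -- With off-diagonal entries `-1 / 2` in the metric, the numerator is proportional to the real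
  -- part of a multiple of `1 + ω + ω² = 0`.
  have h2 : (2 * I * c * (M.dir a * M.dir a)).re + (2 * I * c * (M.dir (a + 1) * M.dir a)).re +
      (2 * I * c * (M.dir (a + 1) * M.dir (a + 1))).re = 0 := by
    rw [← add_re, ← add_re, dir_add_one]
    rw [show 2 * I * c * (M.dir a * M.dir a) + 2 * I * c * (omega * M.dir a * M.dir a) +
      2 * I * c * (omega * M.dir a * (omega * M.dir a)) = 0 by
        linear_combination (2 * I * c * M.dir a ^ 2) * omega_sq, zero_re]
  rw [mul_comm (M.dir a) (M.dir (a + 1))]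
  linear_combination (conformalFactor g (fun _ => 2 * I * c) z *
    (3 / 4 * conformalFactor g (fun _ => 2 * I * c) z ^ 2)⁻¹ * 2⁻¹) * h2

theorem discreteGauss_sc (hg : Differentiable ℂ g) (hg' : ∀ z, deriv g z ≠ 0) (hc : c ≠ 0)
    (hQ : ∀ j, M.SC k (M.coeff qd j) fun _ => c) {X : ℕ → HexVertex → E3}
    (hX : ∀ n, IsWeierstrassRealization g (M.z n) (qd n) (X n)) :
    M.SC k (fun n => discreteGauss (X n) fun v => pseudoNormal (g (M.z n v)))
      fun z => -‖2 * I * c‖ ^ 2 / conformalFactor g (fun _ => 2 * I * c) z ^ 2 := by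
  refine areaAverage_sc hg hg' hc hQ hX fun a => ?_
  have hp : ∀ z, 0 < conformalFactor g (fun _ => 2 * I * c) z := fun z =>
    conformalFactor_pos (by simpa using hc) (hg' z)
  have s := scaledSecond_sc hg hg' hQ
  have h := (((s a a).mul (s (a + 1) (a + 1))).sub ((s a (a + 1)).mul (s (a + 1) a))).mul
    ((scaledDet_sc hg hg' hQ a).inv fun z => by
      have := hp z
      positivity)
  simp only [gaussOf_tri (hX _)]
  refine h.congr_limit fun z => ?_
  have h1 : ‖2 * I * c‖ ^ 2 = ‖2 * I * c * M.dir a ^ 2‖ ^ 2 := by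
    have h2 : ‖M.dir a‖ = 1 := by
      rw [dir, norm_mul, M.norm_ζ, norm_pow, norm_omega]
      simp
    rw [norm_mul _ (M.dir a ^ 2), norm_pow, h2, one_pow, mul_one]
  have hz := (hp z).ne'
  rw [h1]
  generalize conformalFactor g (fun _ => 2 * I * c) z = t at hz
  rw [dir_add_one, show 2 * I * c * (M.dir a * M.dir a) = 2 * I * c * M.dir a ^ 2 by ring,
    show 2 * I * c * (omega * M.dir a * (omega * M.dir a)) =
      omega ^ 2 * (2 * I * c * M.dir a ^ 2) by ring,
    show 2 * I * c * (M.dir a * (omega * M.dir a)) = omega * (2 * I * c * M.dir a ^ 2) by ring,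
    show 2 * I * c * (omega * M.dir a * M.dir a) = omega * (2 * I * c * M.dir a ^ 2) by ring]
  -- It remains that `Re u Re (ω² u) - (Re (ω u))² = -3/4 ‖u‖²`; the factor `3/4` cancels against
  -- the one in the Gram determinant.
  generalize 2 * I * c * M.dir a ^ 2 = u
  rw [norm_sq_eq, omega_sq, omega_eq]
  have h3 : √3 ^ 2 = 3 := Real.sq_sqrt (by norm_num)
  simp only [mul_re, sub_re, neg_re, one_re, sub_im, neg_im, one_im]
  field_simp
  ring_nf
  rw [h3]
  ring

end Limits

end Mesh

end DiscreteWeierstrass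

end

theorem mainTheorem2
    -- the lattices: homothetic images of a regular hexagonal lattice of edge length one
    (p ζ : ℂ) (hζ : ‖ζ‖ = 1)
    (l : ℕ → ℝ) (hl : ∀ n, 0 < l n) (hl0 : Tendsto l atTop (𝓝 0))
    -- the holomorphic data
    (g q : ℂ → ℂ) (hg : Differentiable ℂ g) (hg' : ∀ z, deriv g z ≠ 0) (hq : Differentiable ℂ q)
    (hnd : ∀ n, NonDegenerate g (coord p ζ (l n)))
    (qd : ℕ → HexVertex → Fin 3 → ℂ)
    (hqd : ∀ n, IsHolomorphicQuadraticDifferential g (coord p ζ (l n)) (qd n))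
    (hcommon : Discretise (fun n => coord p ζ (l n)) qd q)
    -- the discrete surfaces given by the data, with their constants of integration
    (X : ℕ → HexVertex → E3)
    (hX : ∀ n, IsWeierstrassRealization g (coord p ζ (l n)) (qd n) (X n))
    (v₀ : HexVertex) (x₀ : E3) (hx₀ : Tendsto (fun n => X n v₀) atTop (𝓝 x₀))
    -- the classical surface, the pseudo-normals, and the regular part
    (Xlim : ℂ → E3) (hXlim : Xlim = weierstrassSurface g (fun z => 2 * I * q z) x₀)
    (N : ℕ → HexVertex → E3) (hN : N = fun n v => pseudoNormal (g (coord p ζ (l n) v)))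
    (U : Set ℂ) (hU : U = {z | q z ≠ 0}) :
    (∀ n, IsDiscreteHarmonic (X n)) ∧
    ContDiff ℝ ∞ Xlim ∧
    IsMinimalImmersionOn Xlim U ∧
    (∀ z ∈ U, unitNormal Xlim z = pseudoNormal (g z)) ∧
    (∀ (c : ℂ) (R : ℝ), 0 < R →
      Tendsto (fun n => Metric.hausdorffEDist
        (X n '' {v | coord p ζ (l n) v ∈ Metric.closedBall c R})
        (Xlim '' Metric.closedBall c R)) atTop (𝓝 0)) ∧
    SmoothlyConvergesOn p ζ l X Xlim Set.univ ∧
    SmoothlyConvergesOn p ζ l (fun n => discreteMean (X n) (N n)) (smoothMean Xlim) U ∧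
    SmoothlyConvergesOn p ζ l (fun n => discreteGauss (X n) (N n)) (smoothGauss Xlim) U := by
  let M : Mesh := ⟨p, ζ, l, hζ, hl, hl0⟩
  obtain ⟨hconst, hQ⟩ := Mesh.coeff_sc (M := M) hg hg' hq hnd hqd hcommon
  have hs : (fun z => 2 * I * q z) = fun _ => 2 * I * q 0 := funext fun z => by rw [hconst]
  rw [hs] at hXlim
  have hd : Differentiable ℂ fun _ : ℂ => 2 * I * q 0 := differentiable_const _
  have hXs : ∀ k, M.SC k X Xlim := hXlim ▸ Mesh.realization_sc (M := M) hg hg' hQ hX hx₀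
  have hNd : Differentiable ℝ fun z => pseudoNormal (g z) :=
    (pseudoNormal_comp_sc (M := M) hg 0).diff
  have hU' : ∀ z ∈ U, 2 * I * q 0 ≠ 0 := fun z hz => by
    rw [hU] at hz
    have h : q z ≠ 0 := hz
    rw [hconst] at h
    simpa using h
  refine ⟨fun n => Mesh.isDiscreteHarmonic (M := M) (hnd n) (hqd n) (hX n), (hXs 0).smooth,
    ⟨(hXs 0).smooth.contDiffOn, fun z hz => ?_⟩, fun z hz => ?_,
    fun c R hR => (hXs 0).conv.hausdorff (hXs 0).smooth.continuous c hR,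
    Mesh.SC.smoothlyConvergesOn hXs _, ?_, ?_⟩
  · rw [hXlim]
    exact ⟨linearIndependent_partials hg hg' hd x₀ (hU' z hz),
      smoothMean_weierstrassSurface hg hg' (hU' z hz) x₀ hNd z⟩
  · rw [hXlim]
    exact unitNormal_weierstrassSurface hg hg' hd x₀ (hU' z hz)
  -- As `q` is constant, `U` is empty, where nothing is claimed, or `q 0 ≠ 0` and convergence holds
  -- on the whole plane.
  · rcases U.eq_empty_or_nonempty with rfl | ⟨z, hz⟩
    · intro K _ hK ws ε _
      exact Eventually.of_forall fun n v hv => absurd (hK hv) (Set.notMem_empty _)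
    · have h0 : q 0 ≠ 0 := by simpa using hU' z hz
      refine Mesh.SC.smoothlyConvergesOn (M := M) (fun k => ?_) _
      rw [hN]
      exact (Mesh.discreteMean_sc (M := M) hg hg' h0 (fun j => hQ j k) hX).congr_limit fun z' => by
        rw [hXlim, smoothMean_weierstrassSurface hg hg' (hU' z hz) x₀ hNd]
  · rcases U.eq_empty_or_nonempty with rfl | ⟨z, hz⟩
    · intro K _ hK ws ε _
      exact Eventually.of_forall fun n v hv => absurd (hK hv) (Set.notMem_empty _)
    · have h0 : q 0 ≠ 0 := by simpa using hU' z hz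
      refine Mesh.SC.smoothlyConvergesOn (M := M) (fun k => ?_) _
      rw [hN]
      exact (Mesh.discreteGauss_sc (M := M) hg hg' h0 (fun j => hQ j k) hX).congr_limit fun z' => by
        rw [hXlim, smoothGauss_weierstrassSurface hg hg' (hU' z hz) x₀ hNd]
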